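/- Let $k\ge1$, $p\ge0$, $d\ge0$ be integers and $\mathbb{Z}_k=\{0,\dots,k-1\}$. Let $G=(V,E)$ be a finite simple $(d+1)$-regular graph of girth at least $2p+2$ (the girth of an acyclic graph is $\infty$), let $\varphi:\mathbb{Z}_k\times\mathbb{Z}_k\to\mathbb{R}$ be symmetric and $C(x)=\sum_{\{u,v\}\in E}\varphi(x_u,x_v)$ for $x\in\mathbb{Z}_k^V$. Let $|\psi\rangle\in\mathbb{C}^k$ be a unit vector, $\gamma_1,\dots,\gamma_p\in\mathbb{R}$, $\beta_1,\dots,\beta_p\in\mathbb{R}^{\ell}$, and let $U_B(\beta)$ be a $k\times k$ unitary matrix for every $\beta\in\mathbb{R}^\ell$. The $p$-layer QAOA state on one $k$-level qudit per vertex is $$|\gamma,\beta\rangle=\Big(\prod_{t=p}^{1}U_B(\beta_t)^{\otimes V}e^{-i\gamma_tC}\Big)|\psi\rangle^{\otimes V},$$ where $C$ acts as a diagonal operator and layer $t=1$ acts first. Write ditstrings as $a=(a_1,\dots,a_{p+1},a_{-p-1},\dots,a_{-1})\in\mathbb{Z}_k^{2p+2}$ and set $$f(a)=\prod_{t=1}^p\langle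 a_t|U_B(\beta_t)^\dagger|a_{t+1}\rangle\langle a_{-t-1}|U_B(\beta_t)|a_{-t}\rangle\cdot\mathbf 1[a_{p+1}=a_{-p-1}]\,\langle\psi|a_1\rangle\langle a_{-1}|\psi\rangle,$$ $$\Phi(a,b)=\sum_{t=1}^p\gamma_t\big(\varphi(a_t,b_t)-\varphi(a_{-t},b_{-t})\big),$$ $$H^{(0)}(a)=1,\qquad H^{(r)}(a)=\Big(\sum_{b\in\mathbb{Z}_k^{2p+2}}f(b)H^{(r-1)}(b)e^{i\Phi(a,b)}\Big)^d\quad(1\le r\le p).$$ Let $Z_u$ be the operator $\mathrm{diag}(0,\dots,k-1)$ on qudit $u$. Then for every $\xi:\mathbb{Z}_k\times\mathbb{Z}_k\to\mathbb{R}$ and every ordered pair $(u,v)$ with $\{u,v\}\in E$, $$\langle\gamma,\beta|\xi(Z_u,Z_v)|\gamma,\beta\rangle=\nu:=\sum_{a,b\in\mathbb{Z}_k^{2p+2}}\xi(a_{p+1},b_{p+1})\,f(a)H^{(p)}(a)\,f(b)H^{(p)}(b)\,e^{i\Phi(a,b)}.$$ In particular the expectation does not depend on the edge. Moreover, there are one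 program and one constant $K$, independent of all the data, such that for all $p\ge1$ and all data as above the program computes $\nu$ from $k$, $p$, $d$ and the values of $\varphi$, $\xi$, $\gamma_t$, $\langle a|U_B(\beta_t)|b\rangle$, $\langle a|\psi\rangle$ (given as read-only input) in at most $K\,p\,k^{4p+4}$ steps and with at most $K\,k^{2p+2}$ memory cells. Each cell holds a complex number; in addition the program uses a fixed number of integer index registers with values below $K\,k^{2p+2}$. One step is an exact complex addition, subtraction, multiplication, conjugation, exponential or $d$-th power, an integer operation on index registers, a memory or input access, or a control step. -/

import Mathlib

open scoped Matrix

noncomputable section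

namespace QuditQAOA

/-! ## The qudit QAOA state on a graph

Computational basis states of the qudits on the vertex set `V` are the labelings
`x : V → Fin k`; operators are matrices in that basis. -/

section State

variable {V : Type*} [Fintype V] [DecidableEq V] {k : ℕ}

/-- The cost function `C(x) = ∑_{{u,v} ∈ E} φ(x_u, x_v)`. Edges are unordered, hence `φ` has to be
symmetric for the sum to make sense. -/
def cost (G : SimpleGraph V) [DecidableRel G.Adj] (φ : Fin k → Fin k → ℝ)
    (hφ : ∀ a b, φ a b = φ b a) (x : V → Fin k) : ℝ :=
  ∑ e ∈ G.edgeFinset, Sym2.lift ⟨fun u v => φ (x u) (x v), fun u v => hφ (x u) (x v)⟩ e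

/-- The diagonal cost Hamiltonian. -/
def costHamiltonian (G : SimpleGraph V) [DecidableRel G.Adj] (φ : Fin k → Fin k → ℝ)
    (hφ : ∀ a b, φ a b = φ b a) : Matrix (V → Fin k) (V → Fin k) ℂ :=
  Matrix.diagonal fun x => (cost G φ hφ x : ℂ)

/-- The phaser `U_C(γ) = exp(-i γ C)`. -/
def phaser (G : SimpleGraph V) [DecidableRel G.Adj] (φ : Fin k → Fin k → ℝ)
    (hφ : ∀ a b, φ a b = φ b a) (γ : ℝ) : Matrix (V → Fin k) (V → Fin k) ℂ :=
  NormedSpace.exp ((-(Complex.I * (γ : ℂ))) • costHamiltonian G φ hφ)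

/-- The product operator `B^{⊗ V}`. -/
def productOperator (V : Type*) [Fintype V] {k : ℕ} (B : Matrix (Fin k) (Fin k) ℂ) :
    Matrix (V → Fin k) (V → Fin k) ℂ :=
  Matrix.of fun x y => ∏ u, B (x u) (y u)

/-- The product state `|ψ⟩^{⊗ V}`. -/
def productState (V : Type*) [Fintype V] {k : ℕ} (ψ : EuclideanSpace ℂ (Fin k)) :
    (V → Fin k) → ℂ :=
  fun x => ∏ u, ψ (x u)

/-- The `p`-layer QAOA state
`U_M(β_p) U_C(γ_p) ⋯ U_M(β_1) U_C(γ_1) |ψ⟩^{⊗ V}`, where `B t` is the single-qudit mixer of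
layer `t`; layers are numbered from `0` to `p - 1`, and layer `0` acts first. -/
def qaoaState (G : SimpleGraph V) [DecidableRel G.Adj] (φ : Fin k → Fin k → ℝ)
    (hφ : ∀ a b, φ a b = φ b a) {p : ℕ} (γ : Fin p → ℝ) (B : Fin p → Matrix (Fin k) (Fin k) ℂ)
    (ψ : EuclideanSpace ℂ (Fin k)) : (V → Fin k) → ℂ :=
  (List.ofFn fun t : Fin p => productOperator V (B t) * phaser G φ hφ (γ t)).reverse.prod *ᵥ
    productState V ψ

/-- The observable `ξ(Z_u, Z_v)`, where `Z_u` is `diag(0, …, k - 1)` on qudit `u`. -/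
def edgeObservable (ξ : Fin k → Fin k → ℝ) (u v : V) : Matrix (V → Fin k) (V → Fin k) ℂ :=
  Matrix.diagonal fun x => (ξ (x u) (x v) : ℂ)

/-- The expectation `⟨γ,β| ξ(Z_u, Z_v) |γ,β⟩`. -/
def edgeExpectation (G : SimpleGraph V) [DecidableRel G.Adj] (φ : Fin k → Fin k → ℝ)
    (hφ : ∀ a b, φ a b = φ b a) {p : ℕ} (γ : Fin p → ℝ) (B : Fin p → Matrix (Fin k) (Fin k) ℂ)
    (ψ : EuclideanSpace ℂ (Fin k)) (ξ : Fin k → Fin k → ℝ) (u v : V) : ℂ :=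
  star (qaoaState G φ hφ γ B ψ) ⬝ᵥ (edgeObservable ξ u v *ᵥ qaoaState G φ hφ γ B ψ)

end State

/-! ## The iterative formula -/

section Formula

variable {k p : ℕ}

/-- Ditstrings `(a_1, …, a_{p+1}, a_{-p-1}, …, a_{-1})` of length `2 p + 2`. -/
abbrev DitString (k p : ℕ) : Type := Fin (2 * p + 2) → Fin k

/-- The entry `a_{j+1}`, for `0 ≤ j ≤ p`. -/
def DitString.pos (a : DitString k p) (j : Fin (p + 1)) : Fin k :=
  a ⟨j, by omega⟩

/-- The entry `a_{-(j+1)}`, for `0 ≤ j ≤ p`. -/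
def DitString.neg (a : DitString k p) (j : Fin (p + 1)) : Fin k :=
  a ⟨2 * p + 1 - j, by omega⟩

/-- The weight
`f(a) = ∏_t ⟨a_t|B_t†|a_{t+1}⟩ ⟨a_{-t-1}|B_t|a_{-t}⟩ · 1[a_{p+1} = a_{-p-1}] ⟨ψ|a_1⟩ ⟨a_{-1}|ψ⟩`. -/
def weight (B : Fin p → Matrix (Fin k) (Fin k) ℂ) (ψ : EuclideanSpace ℂ (Fin k))
    (a : DitString k p) : ℂ :=
  (∏ t : Fin p, (B t)ᴴ (a.pos t.castSucc) (a.pos t.succ) *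
      (B t) (a.neg t.succ) (a.neg t.castSucc)) *
    (if a.pos (Fin.last p) = a.neg (Fin.last p) then 1 else 0) *
    star (ψ (a.pos 0)) * ψ (a.neg 0)

/-- The phase `Φ(a, b) = ∑_t γ_t (φ(a_t, b_t) - φ(a_{-t}, b_{-t}))`. -/
def phase (φ : Fin k → Fin k → ℝ) (γ : Fin p → ℝ) (a b : DitString k p) : ℝ :=
  ∑ t : Fin p, γ t * (φ (a.pos t.castSucc) (b.pos t.castSucc) -
    φ (a.neg t.castSucc) (b.neg t.castSucc))

/-- The tensors `H^{(0)} = 1`, `H^{(r)}(a) = (∑_b f(b) H^{(r-1)}(b) e^{iΦ(a,b)})^d`. -/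
def branchTensor (φ : Fin k → Fin k → ℝ) (γ : Fin p → ℝ) (B : Fin p → Matrix (Fin k) (Fin k) ℂ)
    (ψ : EuclideanSpace ℂ (Fin k)) (d : ℕ) : ℕ → DitString k p → ℂ
  | 0 => fun _ => 1
  | r + 1 => fun a => (∑ b : DitString k p, weight B ψ b * branchTensor φ γ B ψ d r b *
      Complex.exp (Complex.I * (phase φ γ a b : ℂ))) ^ d

/-- `∑_{a,b} ξ(a_{p+1}, b_{p+1}) f(a) H^{(p)}(a) f(b) H^{(p)}(b) e^{iΦ(a,b)}`. -/
def edgeValue (φ : Fin k → Fin k → ℝ) (γ : Fin p → ℝ) (B : Fin p → Matrix (Fin k) (Fin k) ℂ)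
    (ψ : EuclideanSpace ℂ (Fin k)) (d : ℕ) (ξ : Fin k → Fin k → ℝ) : ℂ :=
  ∑ a : DitString k p, ∑ b : DitString k p,
    (ξ (a.pos (Fin.last p)) (b.pos (Fin.last p)) : ℂ) *
      (weight B ψ a * branchTensor φ γ B ψ d p a) *
      (weight B ψ b * branchTensor φ γ B ψ d p b) *
      Complex.exp (Complex.I * (phase φ γ a b : ℂ))

end Formula

/-! ## A unit-cost machine

A machine of size `S` has `S` memory cells, each holding a complex number, and index registers,
each holding a natural number smaller than `S`. A program is a finite text with bounded loops; it
mentions finitely many index registers. Memory is addressed through index registers. The input is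
read-only: natural number parameters, and arrays of complex numbers. Each elementary operation
takes one step; overflow of an index register or an address outside of the memory aborts the
run. -/

/-- The read-only input. -/
structure Input where
  /-- natural number parameters -/
  param : ℕ → ℕ
  /-- `data s n` is entry `n` of array `s` -/
  data : ℕ → ℕ → ℂ

/-- The contents of the index registers and of the memory. -/
structure Store where
  reg : ℕ → ℕ
  mem : ℕ → ℂ

/-- Operations on natural numbers. -/
inductive IndexOp
  | add | sub | mul | div | mod

def IndexOp.eval : IndexOp → ℕ → ℕ → ℕ
  | add, m, n => m + n
  | sub, m, n => m - n
  | mul, m, n => m * n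
  | div, m, n => m / n
  | mod, m, n => m % n

/-- Constants available to programs. -/
inductive CellConst
  | zero | one | imag

def CellConst.eval : CellConst → ℂ
  | zero => 0
  | one => 1
  | imag => Complex.I

/-- Unary operations on complex numbers; `pow n` raises to the power given by parameter `n` of the
input. -/
inductive CellFun
  | copy | conj | exp | pow (n : ℕ)

def CellFun.eval (inp : Input) : CellFun → ℂ → ℂ
  | copy, z => z
  | conj, z => star z
  | exp, z => Complex.exp z
  | pow n, z => z ^ inp.param n

/-- Binary operations on complex numbers. -/
inductive CellOp
  | add | sub | mul

def CellOp.eval : CellOp → ℂ → ℂ → ℂ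
  | add, z, w => z + w
  | sub, z, w => z - w
  | mul, z, w => z * w

/-- Elementary instructions. Arguments `i j l` are names of index registers; `[i]` is the memory
cell whose address is in register `i`. -/
inductive Instr
  /-- `i := c` -/
  | const (i c : ℕ)
  /-- `i := param n` -/
  | param (i n : ℕ)
  /-- `i := j op l` -/
  | index (o : IndexOp) (i j l : ℕ)
  /-- `[i] := c` -/
  | cellConst (c : CellConst) (i : ℕ)
  /-- `[i] := data s j` -/
  | read (i s j : ℕ)
  /-- `[i] := g [j]` -/
  | cellFun (g : CellFun) (i j : ℕ)
  /-- `[i] := [j] op [l]` -/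
  | cellOp (o : CellOp) (i j l : ℕ)

/-- Write an index register; aborts on overflow. -/
def Store.setReg (S : ℕ) (s : Store) (i n : ℕ) : Option Store :=
  if n < S then some { s with reg := Function.update s.reg i n } else none

/-- Read the memory cell addressed by register `i`. -/
def Store.get (S : ℕ) (s : Store) (i : ℕ) : Option ℂ :=
  if s.reg i < S then some (s.mem (s.reg i)) else none

/-- Write the memory cell addressed by register `i`. -/
def Store.put (S : ℕ) (s : Store) (i : ℕ) (z : ℂ) : Option Store :=
  if s.reg i < S then some { s with mem := Function.update s.mem (s.reg i) z } else none

/-- The effect of an instruction; `none` is an aborted run. -/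
def Instr.exec (S : ℕ) (inp : Input) : Instr → Store → Option Store
  | const i c, s => s.setReg S i c
  | param i n, s => s.setReg S i (inp.param n)
  | index o i j l, s => s.setReg S i (o.eval (s.reg j) (s.reg l))
  | cellConst c i, s => s.put S i c.eval
  | read i r j, s => s.put S i (inp.data r (s.reg j))
  | cellFun g i j, s => (s.get S j).bind fun z => s.put S i (g.eval inp z)
  | cellOp o i j l, s =>
      (s.get S j).bind fun z => (s.get S l).bind fun w => s.put S i (o.eval z w)

/-- Programs. -/
inductive Prog
  | instr (c : Instr)
  | seq (P Q : Prog)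
  /-- if registers `i` and `j` are equal then `P` else `Q` -/
  | ifEq (i j : ℕ) (P Q : Prog)
  /-- for `i = 0, …, m - 1` do `P`, where `m` is the initial value of register `n` -/
  | loop (i n : ℕ) (P : Prog)

/-- Run `body` for `i = 0, …, m - 1`, counting the steps; the loop takes one step of its own, and
one more for each round. -/
def iterate (body : Store → Option (Store × ℕ)) (i : ℕ) : ℕ → Store → Option (Store × ℕ)
  | 0, s => some (s, 1)
  | m + 1, s => (iterate body i m s).bind fun q =>
      (body { q.1 with reg := Function.update q.1.reg i m }).map fun q' =>
        (q'.1, q.2 + 1 + q'.2)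

/-- Run a program on a machine of size `S`: the final store and the number of steps, or `none` if
the run is aborted. -/
def Prog.exec (S : ℕ) (inp : Input) : Prog → Store → Option (Store × ℕ)
  | instr c, s => (c.exec S inp s).map fun s' => (s', 1)
  | seq P Q, s => (P.exec S inp s).bind fun q =>
      (Q.exec S inp q.1).map fun q' => (q'.1, q.2 + q'.2)
  | ifEq i j P Q, s =>
      (if s.reg i = s.reg j then P.exec S inp s else Q.exec S inp s).map fun q => (q.1, q.2 + 1)
  | loop i n P, s => iterate (P.exec S inp) i (s.reg n) s

/-- On a machine of size `S`, started with zeros in all registers and cells, the program `P` stops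
on the input `inp` after at most `T` steps, with `z` in cell `0`. -/
def Prog.Computes (P : Prog) (inp : Input) (S T : ℕ) (z : ℂ) : Prop :=
  ∃ (s : Store) (t : ℕ),
    P.exec S inp ⟨fun _ => 0, fun _ => 0⟩ = some (s, t) ∧ t ≤ T ∧ s.mem 0 = z

/-! ## The input of the evaluation procedure -/

section Encoding

variable {k p : ℕ}

/-- Row-by-row listing of a square table. -/
def listTable (F : Fin k → Fin k → ℂ) (n : ℕ) : ℂ :=
  if h : n < k * k then F (Fin.divNat ⟨n, h⟩) (Fin.modNat ⟨n, h⟩) else 0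

/-- The parameters are `k`, `p`, `d`; the arrays are the values of `φ`, the values of `ξ`, the
angles `γ_t`, the matrix elements of the single-qudit mixers `B_t` layer by layer, and the
components of `ψ`. -/
def encode (φ : Fin k → Fin k → ℝ) (γ : Fin p → ℝ) (B : Fin p → Matrix (Fin k) (Fin k) ℂ)
    (ψ : EuclideanSpace ℂ (Fin k)) (d : ℕ) (ξ : Fin k → Fin k → ℝ) : Input where
  param
    | 0 => k
    | 1 => p
    | 2 => d
    | _ => 0
  data
    | 0 => listTable fun a b => (φ a b : ℂ)
    | 1 => listTable fun a b => (ξ a b : ℂ)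
    | 2 => fun n => if h : n < p then (γ ⟨n, h⟩ : ℂ) else 0
    | 3 => fun n => if h : n < p * (k * k) then
        listTable (B (Fin.divNat ⟨n, h⟩)) (Fin.modNat ⟨n, h⟩ : Fin (k * k)) else 0
    | 4 => fun n => if h : n < k then ψ ⟨n, h⟩ else 0
    | _ => fun _ => 0

end Encoding

end QuditQAOA

end

open scoped Matrix

noncomputable section

namespace QuditQAOA

/-! ## Balls around an edge in a graph of large girth -/

/-! In the Heisenberg picture, conjugation by a mixer preserves the set of qudits on which an
observable acts, and conjugation by a phaser enlarges it by one graph step and involves only the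
edges that meet it. So the expectation on the edge `{u, v}` is unchanged when only the edges meeting
the ball of radius `p - 1` around it are kept (`expectation_congr_of_ball`). By the girth condition
these edges form a tree in which each vertex at distance less than `p` has exactly `d` children
(`card_children`, `treeEdges_succ`). Edges between two vertices at distance `p` may exist, but they
lie outside the light cone.

Inserting complete bases between the layers, in the bra and in the ket, labels each vertex by a
ditstring: one half is the bra path, the other the ket path. The expectation becomes a sum over
labelings of a product of vertex weights `f` and edge phases `e^{iΦ}` (`expectation_diagonal`). The
weights are complex but sum to 1 (`sum_weight`), so a vertex can be summed out as if it were an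
independent random variable (`sum_leaves`). Summing out the outermost sphere gives each parent `d`
equal factors, that is, one step of the recursion for `H` (`treeSum_succ`). After `p` such steps
only `u` and `v` remain, and the sum is the formula.

For the complexity, the phase factor of two ditstrings is `E(bra, bra') * conj E(ket, ket')`, where
`E` depends on two paths only. A table of `E` has `k^(2p+2)` entries and takes `O(p)` steps per
entry; so does a table of `f`. With both tables each summand costs `O(1)`, and the `p` tensor
updates and the final double sum take `O(p k^(4p+4))` steps (`runs_branchTerm`,
`runs_evaluateMain`). For `k = 1` the memory bound is a constant, so not even `p` fits into a
register; there the value is `ξ(0,0)` and is read off directly. -/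

theorem egirth_le_of_two_walks {V : Type*} [DecidableEq V] {G : SimpleGraph V} {w y y' z : V} (h : G.Adj w y)
    (h' : G.Adj w y') (hne : y ≠ y') (q : G.Walk y z) (q' : G.Walk y' z) (hq : w ∉ q.support)
    (hq' : w ∉ q'.support) : G.egirth ≤ ((q.length + q'.length + 2 : ℕ) : ℕ∞) := by
  set p := SimpleGraph.Walk.cons h q.bypass with hp
  set p' := SimpleGraph.Walk.cons h' q'.bypass with hp'
  have hpP : p.IsPath := (SimpleGraph.Walk.bypass_isPath q).cons
    fun hw => hq (SimpleGraph.Walk.support_bypass_subset_support q hw)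
  have hpP' : p'.IsPath := (SimpleGraph.Walk.bypass_isPath q').cons
    fun hw => hq' (SimpleGraph.Walk.support_bypass_subset_support q' hw)
  -- The union of the two paths contains a cycle, since paths in an acyclic graph are unique.
  -- Working in this subgraph bounds the length of the cycle by the number of available edges.
  set T : SimpleGraph V := SimpleGraph.fromEdgeSet {e | e ∈ p.edges ∨ e ∈ p'.edges} with hT
  have hTG : T ≤ G := by
    intro a b hab
    rw [hT, SimpleGraph.fromEdgeSet_adj] at hab
    rcases hab.1 with h1 | h1
    · exact p.adj_of_mem_edges h1
    · exact p'.adj_of_mem_edges h1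
  have hin : ∀ e ∈ p.edges, e ∈ T.edgeSet := by
    intro e he
    rw [hT, SimpleGraph.edgeSet_fromEdgeSet]
    exact ⟨Or.inl he, G.not_isDiag_of_mem_edgeSet (p.edges_subset_edgeSet he)⟩
  have hin' : ∀ e ∈ p'.edges, e ∈ T.edgeSet := by
    intro e he
    rw [hT, SimpleGraph.edgeSet_fromEdgeSet]
    exact ⟨Or.inr he, G.not_isDiag_of_mem_edgeSet (p'.edges_subset_edgeSet he)⟩
  have hcyc : ¬ T.IsAcyclic := by
    intro hac
    have := (hac.subsingleton_path w z).elim ⟨p.transfer T hin, hpP.transfer hin⟩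
      ⟨p'.transfer T hin', hpP'.transfer hin'⟩
    -- Equal paths would have equal second vertices, but these are `y` and `y'`.
    have h2 := congrArg (fun x : T.Path w z => x.1.support) this
    simp only [SimpleGraph.Walk.support_transfer] at h2
    rw [hp, hp', SimpleGraph.Walk.support_cons, SimpleGraph.Walk.support_cons,
      ← SimpleGraph.Walk.cons_tail_support q.bypass,
      ← SimpleGraph.Walk.cons_tail_support q'.bypass] at h2
    simp only [List.cons.injEq] at h2
    exact hne h2.2.1
  obtain ⟨a, c, hc, -⟩ : ∃ (a : V) (c : T.Walk a a), c.IsCycle ∧ True := by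
    by_contra hno
    exact hcyc fun {a} c hc => hno ⟨a, c, hc, trivial⟩
  refine (SimpleGraph.egirth_anti hTG).trans ((SimpleGraph.egirth_le_length hc).trans ?_)
  have hsub : c.edges ⊆ p.edges ++ p'.edges := by
    intro e he
    have := c.edges_subset_edgeSet he
    rw [hT, SimpleGraph.edgeSet_fromEdgeSet] at this
    exact List.mem_append.2 this.1
  have hlen := (hc.isCircuit.isTrail.edges_nodup.subperm hsub).length_le
  rw [List.length_append, SimpleGraph.Walk.length_edges, SimpleGraph.Walk.length_edges,
    SimpleGraph.Walk.length_edges, hp, hp', SimpleGraph.Walk.length_cons,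
    SimpleGraph.Walk.length_cons] at hlen
  have h1 := q.length_bypass_le_length
  have h2 := q'.length_bypass_le_length
  exact_mod_cast (by omega : c.length ≤ q.length + q'.length + 2)

section Girth

variable {V : Type*} [Fintype V] [DecidableEq V] (G : SimpleGraph V) [DecidableRel G.Adj]

/-- The closed neighbourhood of a set of vertices. -/
def closedNbhd (S : Finset V) : Finset V := S ∪ S.biUnion fun y => G.neighborFinset y

/-- The ball of radius `r` around a set of vertices. -/
def ball (S : Finset V) (r : ℕ) : Finset V := (closedNbhd G)^[r] S

variable {G}

theorem mem_closedNbhd {S : Finset V} {w : V} :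
    w ∈ closedNbhd G S ↔ w ∈ S ∨ ∃ y ∈ S, G.Adj y w := by
  simp [closedNbhd]

theorem ball_zero (S : Finset V) : ball G S 0 = S := rfl

theorem ball_succ (S : Finset V) (r : ℕ) : ball G S (r + 1) = closedNbhd G (ball G S r) :=
  Function.iterate_succ_apply' _ _ _

theorem ball_succ_left (S : Finset V) (r : ℕ) : ball G S (r + 1) = ball G (closedNbhd G S) r :=
  Function.iterate_succ_apply _ _ _

theorem mem_ball_succ {S : Finset V} {r : ℕ} {w : V} :
    w ∈ ball G S (r + 1) ↔ w ∈ ball G S r ∨ ∃ y ∈ ball G S r, G.Adj y w := by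
  rw [ball_succ, mem_closedNbhd]

theorem ball_mono (S : Finset V) : Monotone (ball G S) :=
  monotone_nat_of_le_succ fun _ _ hw => mem_ball_succ.2 (Or.inl hw)

/-- That the walk stays inside the ball matters as much as its length: it then avoids every vertex
outside, as `egirth_le_of_two_walks` requires. -/
theorem exists_walk_of_mem_ball {S : Finset V} {r : ℕ} {w : V} (hw : w ∈ ball G S r) :
    ∃ z ∈ S, ∃ q : G.Walk w z, q.length ≤ r ∧ ∀ x ∈ q.support, x ∈ ball G S r := by
  induction r generalizing w with
  | zero => exact ⟨w, hw, .nil, le_rfl, by simpa using hw⟩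
  | succ r ih =>
    rcases mem_ball_succ.1 hw with h | ⟨y, hy, hyw⟩
    · obtain ⟨z, hz, q, hq, hs⟩ := ih h
      exact ⟨z, hz, q, by omega, fun x hx => ball_mono S r.le_succ (hs x hx)⟩
    · obtain ⟨z, hz, q, hq, hs⟩ := ih hy
      refine ⟨z, hz, .cons hyw.symm q, by simpa using hq, ?_⟩
      intro x hx
      rw [SimpleGraph.Walk.support_cons, List.mem_cons] at hx
      rcases hx with rfl | hx
      · exact hw
      · exact ball_mono S r.le_succ (hs x hx)

variable {u v : V}

/-- One extra step across the edge `{u, v}` allows the endpoint to be prescribed. Hence two walks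
can be made to meet at a cost of 1, and not 2. -/
theorem exists_walk_to_of_mem_ball (huv : G.Adj u v) {r : ℕ} {w z : V} (hz : z ∈ ({u, v} : Finset V))
    (hw : w ∈ ball G {u, v} r) :
    ∃ q : G.Walk w z, q.length ≤ r + 1 ∧ ∀ x ∈ q.support, x ∈ ball G {u, v} r := by
  obtain ⟨z', hz', q, hq, hs⟩ := exists_walk_of_mem_ball hw
  by_cases h : z' = z
  · subst h
    exact ⟨q, by omega, hs⟩
  · have hadj : G.Adj z' z := by
      simp only [Finset.mem_insert, Finset.mem_singleton] at hz hz'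
      rcases hz with rfl | rfl <;> rcases hz' with rfl | rfl
      · exact absurd rfl h
      · exact huv.symm
      · exact huv
      · exact absurd rfl h
    refine ⟨q.concat hadj, by simpa using hq, ?_⟩
    intro x hx
    rw [SimpleGraph.Walk.support_concat, List.mem_append] at hx
    rcases hx with hx | hx
    · exact hs x hx
    · rw [List.mem_singleton] at hx
      subst hx
      exact ball_mono _ (Nat.zero_le r) hz

theorem exists_two_walks_of_mem_ball (huv : G.Adj u v) {r : ℕ} {y y' : V}
    (hy : y ∈ ball G {u, v} r) (hy' : y' ∈ ball G {u, v} r) :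
    ∃ (z : V) (q : G.Walk y z) (q' : G.Walk y' z), q.length + q'.length ≤ 2 * r + 1 ∧
      (∀ x ∈ q.support, x ∈ ball G {u, v} r) ∧ ∀ x ∈ q'.support, x ∈ ball G {u, v} r := by
  obtain ⟨z, hz, q, hq, hs⟩ := exists_walk_of_mem_ball hy
  obtain ⟨q', hq', hs'⟩ := exists_walk_to_of_mem_ball huv hz hy'
  exact ⟨z, q, q', by omega, hs, hs'⟩

/-- Two different neighbours in the ball would close a cycle of length at most `2r + 3 ≤ 2p + 1`. -/
theorem eq_of_adj_ball {p : ℕ} (huv : G.Adj u v) (hg : ((2 * p + 2 : ℕ) : ℕ∞) ≤ G.egirth) {r : ℕ}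
    (hr : r + 1 ≤ p) {w y y' : V} (hw : w ∉ ball G {u, v} r) (hy : y ∈ ball G {u, v} r)
    (hy' : y' ∈ ball G {u, v} r) (h : G.Adj y w) (h' : G.Adj y' w) : y = y' := by
  by_contra hne
  obtain ⟨z, q, q', hl, hs, hs'⟩ := exists_two_walks_of_mem_ball huv hy hy'
  have := hg.trans (egirth_le_of_two_walks h.symm h'.symm hne q q' (fun hx => hw (hs _ hx))
    fun hx => hw (hs' _ hx))
  have := Nat.cast_le.1 this
  omega

/-- Here the cycle has length at most `2r + 4`. For `r + 1 = p` this is `2p + 2` and contradicts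
nothing, hence the stronger hypothesis on `r`; the outermost sphere may carry edges. -/
theorem not_adj_of_mem_sphere {p : ℕ} (huv : G.Adj u v)
    (hg : ((2 * p + 2 : ℕ) : ℕ∞) ≤ G.egirth) {r : ℕ} (hr : r + 2 ≤ p) {w w' : V}
    (hw : w ∈ ball G {u, v} (r + 1)) (hw' : w' ∈ ball G {u, v} (r + 1))
    (hwr : w ∉ ball G {u, v} r) (hwr' : w' ∉ ball G {u, v} r) : ¬ G.Adj w w' := by
  intro hadj
  obtain ⟨y, hy, hyw⟩ := (mem_ball_succ.1 hw).resolve_left hwr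
  obtain ⟨y', hy', hyw'⟩ := (mem_ball_succ.1 hw').resolve_left hwr'
  obtain ⟨z, q, q', hl, hs, hs'⟩ := exists_two_walks_of_mem_ball huv hy hy'
  have := hg.trans (egirth_le_of_two_walks hyw.symm hadj (fun h => hwr' (h ▸ hy)) q
    (.cons hyw'.symm q') (fun hx => hwr (hs _ hx)) (by
      rw [SimpleGraph.Walk.support_cons, List.mem_cons]
      rintro (rfl | hx)
      · exact hadj.ne rfl
      · exact hwr (hs' _ hx)))
  rw [SimpleGraph.Walk.length_cons] at this
  have := Nat.cast_le.1 this
  omega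

/-- The sphere of radius `r` around a set of vertices. -/
def sphere (G : SimpleGraph V) [DecidableRel G.Adj] (S : Finset V) : ℕ → Finset V
  | 0 => S
  | r + 1 => ball G S (r + 1) \ ball G S r

theorem sphere_subset_ball (S : Finset V) (r : ℕ) : sphere G S r ⊆ ball G S r := by
  cases r with
  | zero => exact subset_rfl
  | succ r => exact Finset.sdiff_subset

/-- Every vertex of a sphere has exactly one neighbour in the ball. -/
theorem existsUnique_adj_of_mem_sphere {p : ℕ} (huv : G.Adj u v)
    (hg : ((2 * p + 2 : ℕ) : ℕ∞) ≤ G.egirth) {r : ℕ} (hr : r + 1 ≤ p) {y : V}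
    (hy : y ∈ sphere G {u, v} r) : ∃ x, ∀ x', x' ∈ ball G {u, v} r ∧ G.Adj y x' ↔ x' = x := by
  cases r with
  | zero =>
    simp only [sphere, ball_zero, Finset.mem_insert, Finset.mem_singleton] at hy ⊢
    rcases hy with rfl | rfl
    · refine ⟨v, fun x' => ⟨?_, ?_⟩⟩
      · rintro ⟨rfl | rfl, h⟩
        · exact absurd rfl h.ne
        · rfl
      · rintro rfl
        exact ⟨Or.inr rfl, huv⟩
    · refine ⟨u, fun x' => ⟨?_, ?_⟩⟩
      · rintro ⟨rfl | rfl, h⟩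
        · rfl
        · exact absurd rfl h.ne
      · rintro rfl
        exact ⟨Or.inl rfl, huv.symm⟩
  | succ r =>
    simp only [sphere, Finset.mem_sdiff] at hy
    obtain ⟨x, hx, hxy⟩ := (mem_ball_succ.1 hy.1).resolve_left hy.2
    refine ⟨x, fun x' => ⟨?_, ?_⟩⟩
    · rintro ⟨h1, h2⟩
      by_cases h3 : x' ∈ ball G {u, v} r
      · exact eq_of_adj_ball huv hg (by omega) hy.2 h3 hx h2.symm hxy
      · exact absurd h2 (not_adj_of_mem_sphere huv hg (by omega) hy.1 h1 hy.2 h3)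
    · rintro rfl
      exact ⟨mem_ball_succ.2 (Or.inl hx), hxy.symm⟩

/-- Of the `d + 1` neighbours exactly one, the parent (for `r = 0` the other end of the edge), is in
the ball, and the rest are on the next sphere. -/
theorem card_children {p d : ℕ} (hd : G.IsRegularOfDegree (d + 1)) (huv : G.Adj u v)
    (hg : ((2 * p + 2 : ℕ) : ℕ∞) ≤ G.egirth) {r : ℕ} (hr : r + 1 ≤ p) {y : V}
    (hy : y ∈ sphere G {u, v} r) :
    ((sphere G {u, v} (r + 1)).filter (G.Adj y)).card = d := by
  obtain ⟨x, hx⟩ := existsUnique_adj_of_mem_sphere huv hg hr hy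
  have h1 : (sphere G {u, v} (r + 1)).filter (G.Adj y) = (G.neighborFinset y).erase x := by
    ext w
    simp only [sphere, Finset.mem_filter, Finset.mem_sdiff, Finset.mem_erase,
      SimpleGraph.mem_neighborFinset]
    constructor
    · rintro ⟨⟨-, h2⟩, h3⟩
      exact ⟨fun h4 => h2 ((hx w).2 h4).1, h3⟩
    · rintro ⟨h2, h3⟩
      exact ⟨⟨mem_ball_succ.2 (Or.inr ⟨y, sphere_subset_ball _ _ hy, h3⟩),
        fun h4 => h2 ((hx w).1 ⟨h4, h3⟩)⟩, h3⟩
  rw [h1, Finset.card_erase_of_mem ((G.mem_neighborFinset _ _).2 ((hx x).2 rfl).2),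
    SimpleGraph.card_neighborFinset_eq_degree, hd.degree_eq y]
  rfl

theorem mem_sphere_of_adj_sphere_succ {r : ℕ} {S : Finset V} {y w : V}
    (hy : y ∈ ball G S r) (hw : w ∈ sphere G S (r + 1)) (h : G.Adj y w) : y ∈ sphere G S r := by
  simp only [sphere, Finset.mem_sdiff] at hw
  cases r with
  | zero => exact hy
  | succ r =>
    exact Finset.mem_sdiff.2 ⟨hy, fun h2 => hw.2 (mem_ball_succ.2 (Or.inr ⟨y, h2, h⟩))⟩

end Girth

/-! ## Locality of the evolved observable -/

section Locality

variable {V : Type*} [Fintype V] {k : ℕ}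

/-- The tensor product of a family of single-qudit operators. -/
def siteProduct (A : V → Matrix (Fin k) (Fin k) ℂ) : Matrix (V → Fin k) (V → Fin k) ℂ :=
  Matrix.of fun x y => ∏ u, A u (x u) (y u)

theorem siteProduct_conjTranspose (A : V → Matrix (Fin k) (Fin k) ℂ) :
    (siteProduct A)ᴴ = siteProduct fun u => (A u)ᴴ := by
  ext x y
  simp [siteProduct, Matrix.conjTranspose_apply]

theorem productOperator_eq (B : Matrix (Fin k) (Fin k) ℂ) :
    productOperator V B = siteProduct fun _ => B := rfl

variable [DecidableEq V]

theorem siteProduct_mul (A B : V → Matrix (Fin k) (Fin k) ℂ) :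
    siteProduct A * siteProduct B = siteProduct fun u => A u * B u := by
  ext x y
  simp only [siteProduct, Matrix.mul_apply, Matrix.of_apply, ← Finset.prod_mul_distrib]
  exact (Fintype.prod_sum fun u j => A u (x u) j * B u j (y u)).symm

/-- The operator `M` on the qudit `w`. -/
def siteOperator (w : V) (M : Matrix (Fin k) (Fin k) ℂ) : Matrix (V → Fin k) (V → Fin k) ℂ :=
  siteProduct fun u => if u = w then M else 1

theorem siteOperator_apply_eq_zero (w : V) (M : Matrix (Fin k) (Fin k) ℂ) {x y : V → Fin k} {u : V}
    (hu : u ≠ w) (h : x u ≠ y u) : siteOperator w M x y = 0 :=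
  Finset.prod_eq_zero (Finset.mem_univ u) (by simp [hu, Matrix.one_apply_ne h])

theorem siteOperator_single_apply (w : V) (i : Fin k) (x y : V → Fin k) :
    siteOperator w (Matrix.single i i 1) x y = if x = y ∧ x w = i then 1 else 0 := by
  split_ifs with h
  · obtain ⟨rfl, rfl⟩ := h
    refine Finset.prod_eq_one fun u _ => ?_
    beta_reduce
    split_ifs with hu
    · subst hu
      simp
    · simp
  · by_cases hxy : ∃ u, u ≠ w ∧ x u ≠ y u
    · obtain ⟨u, hu, hne⟩ := hxy
      exact siteOperator_apply_eq_zero w _ hu hne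
    · push Not at hxy
      refine Finset.prod_eq_zero (Finset.mem_univ w) ?_
      beta_reduce
      rw [if_pos rfl, Matrix.single_apply]
      refine if_neg fun hi => h ⟨funext fun u => ?_, hi.1.symm⟩
      by_cases hu : u = w
      · subst hu
        exact hi.1.symm.trans hi.2
      · exact hxy u hu

/-- An operator acts on the qudits in `S` only. -/
def SupportedOn (S : Finset V) (O : Matrix (V → Fin k) (V → Fin k) ℂ) : Prop :=
  ∀ w ∉ S, ∀ M : Matrix (Fin k) (Fin k) ℂ, Commute O (siteOperator w M)

/-- The operator commutes with the projector onto the value `x w` at the qudit `w`; comparing the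
`(x, y)` entries of the two products forces `O x y = 0` as soon as `x w ≠ y w`. -/
theorem SupportedOn.eq_of_ne_zero {S : Finset V} {O : Matrix (V → Fin k) (V → Fin k) ℂ}
    (hO : SupportedOn S O) {x y : V → Fin k} (hxy : O x y ≠ 0) {w : V} (hw : w ∉ S) :
    x w = y w := by
  by_contra hne
  have h := congrFun (congrFun (hO w hw (Matrix.single (x w) (x w) 1)).eq x) y
  simp only [Matrix.mul_apply, siteOperator_single_apply] at h
  rw [Finset.sum_eq_zero, Finset.sum_eq_single x] at h
  · simp only [true_and, if_true, one_mul] at h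
    exact hxy h.symm
  · intro z _ hz
    rw [if_neg (fun h => hz h.1.symm), zero_mul]
  · simp
  · intro z _
    by_cases hz : z = y
    · subst hz
      rw [if_neg (fun h => hne h.2.symm), mul_zero]
    · rw [if_neg (fun h => hz h.1), mul_zero]

theorem commute_diagonal_siteOperator (F : (V → Fin k) → ℂ) (w : V)
    (hF : ∀ x y, (∀ u, u ≠ w → x u = y u) → F x = F y) (M : Matrix (Fin k) (Fin k) ℂ) :
    Commute (Matrix.diagonal F) (siteOperator w M) := by
  ext x y
  rw [Matrix.diagonal_mul, Matrix.mul_diagonal, mul_comm]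
  by_cases h : ∀ u, u ≠ w → x u = y u
  · rw [hF x y h]
  · push Not at h
    obtain ⟨u, hu, hne⟩ := h
    rw [siteOperator_apply_eq_zero w M hu hne, zero_mul, zero_mul]

/-- Moving a one-site operator `M` through the product mixer replaces it by `B M Bᴴ` on the same
site, with which `O` commutes as well. -/
theorem SupportedOn.conj_productOperator {S : Finset V} {O : Matrix (V → Fin k) (V → Fin k) ℂ}
    (hO : SupportedOn S O) {B : Matrix (Fin k) (Fin k) ℂ} (hB : Bᴴ * B = 1) :
    SupportedOn S ((productOperator V B)ᴴ * O * productOperator V B) := by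
  intro w hw M
  have h1 : productOperator V B * siteOperator w M =
      siteOperator w (B * M * Bᴴ) * productOperator V B := by
    rw [productOperator_eq, siteOperator, siteOperator, siteProduct_mul, siteProduct_mul]
    congr 1
    ext1 u
    split_ifs
    · rw [Matrix.mul_assoc (B * M), hB, Matrix.mul_one]
    · rw [Matrix.mul_one, Matrix.one_mul]
  have h2 : siteOperator w M * (productOperator V B)ᴴ =
      (productOperator V B)ᴴ * siteOperator w (B * M * Bᴴ) := by
    rw [productOperator_eq, siteProduct_conjTranspose, siteOperator, siteOperator,
      siteProduct_mul, siteProduct_mul]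
    congr 1
    ext1 u
    split_ifs
    · rw [← Matrix.mul_assoc, ← Matrix.mul_assoc, hB, Matrix.one_mul]
    · rw [Matrix.mul_one, Matrix.one_mul]
  show _ * _ = _ * _
  rw [Matrix.mul_assoc, h1, ← Matrix.mul_assoc, Matrix.mul_assoc _ O,
    (hO w hw _).eq, ← Matrix.mul_assoc, ← h2]
  simp only [Matrix.mul_assoc]

variable {φ : Fin k → Fin k → ℝ} {hφ : ∀ a b, φ a b = φ b a}

theorem phaser_eq_diagonal (G : SimpleGraph V) [DecidableRel G.Adj] (γ : ℝ) :
    phaser G φ hφ γ =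
      Matrix.diagonal fun x => Complex.exp (-(Complex.I * γ) * (cost G φ hφ x : ℂ)) := by
  rw [phaser, costHamiltonian, ← Matrix.diagonal_smul, Matrix.exp_diagonal]
  congr 1
  ext x
  rw [Pi.coe_exp, ← Complex.exp_eq_exp_ℂ]
  rfl

/-- An edge with no end in `S` contributes the same to both labelings and cancels. -/
theorem cost_sub_cost {G H : SimpleGraph V} [DecidableRel G.Adj] [DecidableRel H.Adj]
    {S : Finset V} (hGH : ∀ a ∈ S, ∀ b, G.Adj a b ↔ H.Adj a b) {x y : V → Fin k}
    (hxy : ∀ w ∉ S, x w = y w) :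
    cost G φ hφ x - cost G φ hφ y = cost H φ hφ x - cost H φ hφ y := by
  have key : ∀ (K : SimpleGraph V) [DecidableRel K.Adj], cost K φ hφ x - cost K φ hφ y =
      ∑ e ∈ K.edgeFinset.filter (fun e => ∃ a ∈ S, a ∈ e),
        (Sym2.lift ⟨fun u v => φ (x u) (x v), fun u v => hφ (x u) (x v)⟩ e -
          Sym2.lift ⟨fun u v => φ (y u) (y v), fun u v => hφ (y u) (y v)⟩ e) := by
    intro K _
    rw [cost, cost, ← Finset.sum_sub_distrib, Finset.sum_filter_of_ne]
    intro e _ hne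
    by_contra hno
    push Not at hno
    apply hne
    induction e using Sym2.inductionOn with
    | hf a b =>
      have ha : a ∉ S := fun h => hno a h (Sym2.mem_mk_left a b)
      have hb : b ∉ S := fun h => hno b h (Sym2.mem_mk_right a b)
      simp only [Sym2.lift_mk]
      rw [hxy a ha, hxy b hb, sub_self]
  rw [key G, key H]
  congr 1
  ext e
  simp only [Finset.mem_filter, SimpleGraph.mem_edgeFinset]
  refine and_congr_left fun ⟨a, ha, hae⟩ => ?_
  obtain ⟨b, rfl⟩ := Sym2.mem_iff_exists.1 hae
  exact hGH a ha b

/-- Conjugation multiplies the entry `O x y` by `e^{iγ(C(x) - C(y))}`, and nonzero entries have `x =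
y` off `S`, so `cost_sub_cost` applies. -/
theorem SupportedOn.conj_phaser_congr {G H : SimpleGraph V} [DecidableRel G.Adj]
    [DecidableRel H.Adj] {S : Finset V} (hGH : ∀ a ∈ S, ∀ b, G.Adj a b ↔ H.Adj a b)
    {O : Matrix (V → Fin k) (V → Fin k) ℂ} (hO : SupportedOn S O) (γ : ℝ) :
    (phaser G φ hφ γ)ᴴ * O * phaser G φ hφ γ = (phaser H φ hφ γ)ᴴ * O * phaser H φ hφ γ := by
  ext x y
  simp only [phaser_eq_diagonal, Matrix.diagonal_conjTranspose, Matrix.mul_diagonal,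
    Matrix.diagonal_mul, Pi.star_apply]
  by_cases h : O x y = 0
  · rw [h]; ring
  · have hc := cost_sub_cost (φ := φ) (hφ := hφ) hGH
      (fun w hw => hO.eq_of_ne_zero h hw)
    have e : ∀ (K : SimpleGraph V) [DecidableRel K.Adj],
        star (Complex.exp (-(Complex.I * γ) * (cost K φ hφ x : ℂ))) * O x y *
          Complex.exp (-(Complex.I * γ) * (cost K φ hφ y : ℂ)) =
        Complex.exp (Complex.I * γ * ((cost K φ hφ x - cost K φ hφ y : ℝ) : ℂ)) * O x y := by
      intro K _
      rw [Complex.star_def, ← Complex.exp_conj, mul_right_comm, ← Complex.exp_add]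
      congr 2
      simp only [map_mul, map_neg, Complex.conj_I, Complex.conj_ofReal]
      push_cast
      ring
    rw [e G, e H, hc]

theorem SupportedOn.conj_phaser {G : SimpleGraph V} [DecidableRel G.Adj] {S : Finset V}
    {O : Matrix (V → Fin k) (V → Fin k) ℂ} (hO : SupportedOn S O) (γ : ℝ) :
    SupportedOn (closedNbhd G S) ((phaser G φ hφ γ)ᴴ * O * phaser G φ hφ γ) := by
  -- Only the edges meeting `S` matter. Once the others are deleted, the cost does not depend on the
  -- label of any vertex outside of the closed neighbourhood.
  let H : SimpleGraph V :=
    { Adj := fun a b => G.Adj a b ∧ (a ∈ S ∨ b ∈ S)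
      symm := ⟨fun a b h => ⟨h.1.symm, h.2.symm⟩⟩
      loopless := ⟨fun a h => h.1.ne rfl⟩ }
  have : DecidableRel H.Adj := fun a b => inferInstanceAs (Decidable (_ ∧ _))
  rw [hO.conj_phaser_congr (G := G) (H := H)
    (fun a ha b => ⟨fun h => ⟨h, Or.inl ha⟩, fun h => h.1⟩)]
  intro w hw M
  have hwS : w ∉ S := fun h => hw (mem_closedNbhd.2 (Or.inl h))
  have hcost : ∀ x y : V → Fin k, (∀ u, u ≠ w → x u = y u) → cost H φ hφ x = cost H φ hφ y := by
    intro x y hxy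
    refine Finset.sum_congr rfl fun e he => ?_
    rw [SimpleGraph.mem_edgeFinset] at he
    induction e using Sym2.inductionOn with
    | hf a b =>
      rw [SimpleGraph.mem_edgeSet] at he
      have ha : a ≠ w := by
        rintro rfl
        exact hw (mem_closedNbhd.2 (Or.inr ⟨b, he.2.resolve_left hwS, he.1.symm⟩))
      have hb : b ≠ w := by
        rintro rfl
        exact hw (mem_closedNbhd.2 (Or.inr ⟨a, he.2.resolve_right hwS, he.1⟩))
      simp only [Sym2.lift_mk]
      rw [hxy a ha, hxy b hb]
  refine Commute.mul_left (Commute.mul_left ?_ (hO w hwS M)) ?_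
  · rw [phaser_eq_diagonal, Matrix.diagonal_conjTranspose]
    exact commute_diagonal_siteOperator _ w (fun x y h => by simp [hcost x y h]) M
  · rw [phaser_eq_diagonal]
    exact commute_diagonal_siteOperator _ w (fun x y h => by simp [hcost x y h]) M

theorem qaoaState_zero (G : SimpleGraph V) [DecidableRel G.Adj] (γ : Fin 0 → ℝ)
    (B : Fin 0 → Matrix (Fin k) (Fin k) ℂ) (ψ : EuclideanSpace ℂ (Fin k)) :
    qaoaState G φ hφ γ B ψ = productState V ψ := by
  simp [qaoaState]

theorem qaoaState_succ (G : SimpleGraph V) [DecidableRel G.Adj] {p : ℕ} (γ : Fin (p + 1) → ℝ)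
    (B : Fin (p + 1) → Matrix (Fin k) (Fin k) ℂ) (ψ : EuclideanSpace ℂ (Fin k)) :
    qaoaState G φ hφ γ B ψ =
      (productOperator V (B (Fin.last p)) * phaser G φ hφ (γ (Fin.last p))) *ᵥ
        qaoaState G φ hφ (fun t => γ t.castSucc) (fun t => B t.castSucc) ψ := by
  rw [qaoaState, qaoaState, List.ofFn_succ', List.concat_eq_append, List.reverse_append,
    List.reverse_singleton, List.singleton_append, List.prod_cons, Matrix.mulVec_mulVec]

/-- The expectation of a local observable sees only the edges in its light cone. -/
theorem expectation_congr_of_ball {p : ℕ} {G H : SimpleGraph V} [DecidableRel G.Adj]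
    [DecidableRel H.Adj] (γ : Fin p → ℝ) (B : Fin p → Matrix (Fin k) (Fin k) ℂ)
    (hB : ∀ t, (B t)ᴴ * B t = 1) (ψ : EuclideanSpace ℂ (Fin k)) (S : Finset V)
    (hGH : ∀ j < p, ∀ a ∈ ball G S j, ∀ b, G.Adj a b ↔ H.Adj a b)
    (O : Matrix (V → Fin k) (V → Fin k) ℂ) (hO : SupportedOn S O) :
    star (qaoaState G φ hφ γ B ψ) ⬝ᵥ (O *ᵥ qaoaState G φ hφ γ B ψ) =
      star (qaoaState H φ hφ γ B ψ) ⬝ᵥ (O *ᵥ qaoaState H φ hφ γ B ψ) := by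
  induction p generalizing S O with
  | zero => rw [qaoaState_zero, qaoaState_zero]
  | succ p ih =>
    -- The last layer is moved from the state to the observable.
    have step : ∀ (K : SimpleGraph V) [DecidableRel K.Adj],
        star (qaoaState K φ hφ γ B ψ) ⬝ᵥ (O *ᵥ qaoaState K φ hφ γ B ψ) =
        star (qaoaState K φ hφ (fun t => γ t.castSucc) (fun t => B t.castSucc) ψ) ⬝ᵥ
          (((phaser K φ hφ (γ (Fin.last p)))ᴴ * ((productOperator V (B (Fin.last p)))ᴴ * O *
            productOperator V (B (Fin.last p))) * phaser K φ hφ (γ (Fin.last p))) *ᵥ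
          qaoaState K φ hφ (fun t => γ t.castSucc) (fun t => B t.castSucc) ψ) := by
      intro K _
      rw [qaoaState_succ, Matrix.star_mulVec, ← Matrix.dotProduct_mulVec, Matrix.mulVec_mulVec,
        Matrix.mulVec_mulVec, Matrix.conjTranspose_mul]
      simp only [Matrix.mul_assoc]
    have hO' := hO.conj_productOperator (hB (Fin.last p))
    -- The last phaser sees only edges at `S`, the ball of radius 0. The earlier layers then face an
    -- observable on the closed neighbourhood, so all radii shift by one.
    rw [step G, step H, ← hO'.conj_phaser_congr (hGH 0 p.succ_pos)]
    refine ih _ _ (fun t => hB t.castSucc) (closedNbhd G S) (fun j hj a ha b => ?_) _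
      (hO'.conj_phaser _)
    rw [← ball_succ_left] at ha
    exact hGH (j + 1) (by omega) a ha b

theorem supportedOn_edgeObservable (ξ : Fin k → Fin k → ℝ) (u v : V) :
    SupportedOn {u, v} (edgeObservable ξ u v) := by
  intro w hw M
  simp only [Finset.mem_insert, Finset.mem_singleton, not_or] at hw
  refine commute_diagonal_siteOperator _ w (fun x y h => ?_) M
  rw [h u (Ne.symm hw.1), h v (Ne.symm hw.2)]

end Locality

/-! ## The expectation as a sum over ditstrings -/

section PathSum

variable {k p : ℕ}

/-- The amplitude of a single-qudit path, without the phases. -/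
def pathAmplitude (B : Fin p → Matrix (Fin k) (Fin k) ℂ) (ψ : EuclideanSpace ℂ (Fin k))
    (x : Fin (p + 1) → Fin k) : ℂ :=
  (∏ t : Fin p, B t (x t.succ) (x t.castSucc)) * ψ (x 0)

theorem pathAmplitude_snoc (B : Fin (p + 1) → Matrix (Fin k) (Fin k) ℂ)
    (ψ : EuclideanSpace ℂ (Fin k)) (x : Fin (p + 1) → Fin k) (z : Fin k) :
    pathAmplitude B ψ (Fin.snoc (α := fun _ => Fin k) x z) =
      B (Fin.last p) z (x (Fin.last p)) * pathAmplitude (fun t => B t.castSucc) ψ x := by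
  rw [pathAmplitude, pathAmplitude, Fin.prod_univ_castSucc]
  have h0 : (Fin.snoc (α := fun _ => Fin k) x z : Fin (p + 2) → Fin k) 0 = x 0 := by
    rw [← Fin.castSucc_zero, Fin.snoc_castSucc]
  rw [h0, Fin.succ_last, Fin.snoc_last, Fin.snoc_castSucc]
  simp only [← Fin.castSucc_succ, Fin.snoc_castSucc]
  ring

/-- The two branches of a ditstring. -/
def DitString.branches : DitString k p ≃ (Fin (p + 1) → Fin k) × (Fin (p + 1) → Fin k) where
  toFun a := (a.pos, a.neg)
  invFun q i := if h : (i : ℕ) ≤ p then q.1 ⟨i, by omega⟩ else q.2 ⟨2 * p + 1 - i, by omega⟩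
  left_inv a := by
    funext i
    by_cases h : (i : ℕ) ≤ p
    · simp [h, DitString.pos]
    · simp only [h, DitString.neg, dite_false]
      congr 1
      ext
      simp only
      omega
  right_inv q := by
    refine Prod.ext (funext fun j => ?_) (funext fun j => ?_)
    · simp [DitString.pos, Nat.lt_succ_iff.1 j.2]
    · have h : ¬ 2 * p + 1 - (j : ℕ) ≤ p := by omega
      simp only [DitString.neg, h, dite_false]
      exact congrArg q.2 (Fin.ext (Nat.sub_sub_self (by omega : (j : ℕ) ≤ 2 * p + 1)))

theorem DitString.branches_apply (a : DitString k p) : branches a = (a.pos, a.neg) := rfl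

/-- The positive entries form a bra path and the negative ones a ket path; the indicator glues their
ends at the diagonal observable. -/
theorem weight_eq (B : Fin p → Matrix (Fin k) (Fin k) ℂ) (ψ : EuclideanSpace ℂ (Fin k))
    (a : DitString k p) :
    weight B ψ a = if a.pos (Fin.last p) = a.neg (Fin.last p) then
      star (pathAmplitude B ψ a.pos) * pathAmplitude B ψ a.neg else 0 := by
  rw [weight, Finset.prod_mul_distrib]
  split_ifs
  · simp only [pathAmplitude, Matrix.conjTranspose_apply, star_mul', star_prod]
    ring
  · ring

theorem phase_comm {φ : Fin k → Fin k → ℝ} (hφ : ∀ a b, φ a b = φ b a) (γ : Fin p → ℝ)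
    (a b : DitString k p) : phase φ γ a b = phase φ γ b a := by
  simp only [phase, hφ (a.pos _), hφ (a.neg _)]

variable {V : Type*} [Fintype V]

/-- The phase on an edge of a labeling by ditstrings. -/
def edgePhase (φ : Fin k → Fin k → ℝ) (hφ : ∀ a b, φ a b = φ b a) (γ : Fin p → ℝ)
    (c : V → DitString k p) : Sym2 V → ℝ :=
  Sym2.lift ⟨fun u v => phase φ γ (c u) (c v), fun _ _ => phase_comm hφ γ _ _⟩

/-- Labelings by paths of length `p + 1`, split into the last entries and the rest. -/
def splitLast (V : Type*) (k p : ℕ) :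
    (V → Fin k) × (V → Fin (p + 1) → Fin k) ≃ (V → Fin (p + 2) → Fin k) :=
  (Equiv.arrowProdEquivProdArrow V (fun _ => Fin k) (fun _ => Fin (p + 1) → Fin k)).symm.trans
    (Equiv.arrowCongr (Equiv.refl V) (Fin.snocEquiv fun _ : Fin (p + 2) => Fin k))

theorem splitLast_apply (V : Type*) (k p : ℕ) (z : V → Fin k) (a : V → Fin (p + 1) → Fin k)
    (w : V) : splitLast V k p (z, a) w = Fin.snoc (α := fun _ => Fin k) (a w) (z w) := rfl

variable {φ : Fin k → Fin k → ℝ} {hφ : ∀ a b, φ a b = φ b a}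

theorem sum_edgePhase (G : SimpleGraph V) [DecidableRel G.Adj] (γ : Fin p → ℝ)
    (c : V → DitString k p) :
    ∑ e ∈ G.edgeFinset, edgePhase φ hφ γ c e =
      ∑ t : Fin p, γ t * cost G φ hφ (fun w => (c w).pos t.castSucc) -
      ∑ t : Fin p, γ t * cost G φ hφ (fun w => (c w).neg t.castSucc) := by
  rw [← Finset.sum_sub_distrib]
  simp only [cost, ← mul_sub, ← Finset.sum_sub_distrib, Finset.mul_sum]
  rw [Finset.sum_comm]
  refine Finset.sum_congr rfl fun e _ => ?_
  induction e using Sym2.inductionOn with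
  | hf a b => simp only [edgePhase, Sym2.lift_mk, phase]

variable [DecidableEq V]

/-- The path sum: a complete basis is inserted between consecutive layers. Phases do not involve the
last entry of a path, because within a layer the phaser acts before the mixer. -/
theorem qaoaState_apply (G : SimpleGraph V) [DecidableRel G.Adj] (γ : Fin p → ℝ)
    (B : Fin p → Matrix (Fin k) (Fin k) ℂ) (ψ : EuclideanSpace ℂ (Fin k)) (x : V → Fin k) :
    qaoaState G φ hφ γ B ψ x = ∑ a : V → Fin (p + 1) → Fin k,
      if (fun w => a w (Fin.last p)) = x then (∏ w, pathAmplitude B ψ (a w)) *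
        Complex.exp (-(Complex.I *
          ((∑ t : Fin p, γ t * cost G φ hφ (fun w => a w t.castSucc) : ℝ) : ℂ))) else 0 := by
  induction p generalizing x with
  | zero =>
    rw [qaoaState_zero, Fintype.sum_eq_single (fun w _ => x w)]
    · simp [pathAmplitude, productState]
    · intro a ha
      refine if_neg fun h => ha ?_
      funext w t
      rw [← h, Subsingleton.elim (α := Fin 1) t (Fin.last 0)]
  | succ p ih =>
    rw [qaoaState_succ, ← (splitLast V k p).sum_comp, Fintype.sum_prod_type, Finset.sum_comm]
    simp only [splitLast_apply, Fin.snoc_last, pathAmplitude_snoc, Fin.snoc_castSucc]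
    -- The induction hypothesis in the form of a linear functional of the shorter state, so that the
    -- sum over its basis labels collapses at once.
    have hL : ∀ (F : (V → Fin k) → ℂ),
        ∑ y, F y * qaoaState G φ hφ (fun t => γ t.castSucc) (fun t => B t.castSucc) ψ y =
        ∑ a : V → Fin (p + 1) → Fin k, F (fun w => a w (Fin.last p)) *
          ((∏ w, pathAmplitude (fun t => B t.castSucc) ψ (a w)) * Complex.exp (-(Complex.I *
          ((∑ t : Fin p, γ t.castSucc * cost G φ hφ (fun w => a w t.castSucc) : ℝ) : ℂ)))) := by
      intro F
      simp only [ih, Finset.mul_sum, mul_ite, mul_zero]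
      rw [Finset.sum_comm]
      refine Finset.sum_congr rfl fun a _ => ?_
      rw [Finset.sum_ite_eq, if_pos (Finset.mem_univ _)]
    rw [Matrix.mulVec, dotProduct]
    rw [hL]
    refine Finset.sum_congr rfl fun a _ => ?_
    have hx : ∀ z : V → Fin k, ((fun w => z w) = x) ↔ z = x := fun z => Iff.rfl
    simp only [hx, Finset.sum_ite_eq', Finset.mem_univ, if_true]
    rw [phaser_eq_diagonal, Matrix.mul_diagonal, Fin.sum_univ_castSucc, Finset.prod_mul_distrib,
      productOperator, Matrix.of_apply]
    rw [Complex.ofReal_add, mul_add, neg_add, Complex.exp_add, Complex.ofReal_mul]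
    ring_nf

theorem star_dotProduct_qaoaState (G : SimpleGraph V) [DecidableRel G.Adj] (γ : Fin p → ℝ)
    (B : Fin p → Matrix (Fin k) (Fin k) ℂ) (hB : ∀ t, (B t)ᴴ * B t = 1)
    (ψ : EuclideanSpace ℂ (Fin k)) (hψ : ‖ψ‖ = 1) :
    star (qaoaState G φ hφ γ B ψ) ⬝ᵥ qaoaState G φ hφ γ B ψ = 1 := by
  induction p with
  | zero =>
    rw [qaoaState_zero]
    have h1 : ∑ i, star (ψ i) * ψ i = 1 := by
      have h2 := EuclideanSpace.norm_sq_eq ψ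
      rw [hψ] at h2
      have h3 : ((∑ i, ‖ψ i‖ ^ 2 : ℝ) : ℂ) = 1 := by rw [← h2]; norm_num
      rw [← h3]
      push_cast
      exact Finset.sum_congr rfl fun i _ => Complex.conj_mul' _
    simp only [dotProduct, productState, Pi.star_apply, star_prod, ← Finset.prod_mul_distrib]
    rw [← Fintype.prod_sum (fun (_ : V) i => star (ψ i) * ψ i), h1, Finset.prod_const_one]
  | succ p ih =>
    have h1 : (productOperator V (B (Fin.last p)))ᴴ * productOperator V (B (Fin.last p)) = 1 := by
      rw [productOperator_eq, siteProduct_conjTranspose, siteProduct_mul, hB]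
      ext x y
      rw [siteProduct, Matrix.of_apply, Matrix.one_apply]
      split_ifs with h
      · subst h
        simp
      · obtain ⟨w, hw⟩ := Function.ne_iff.1 h
        exact Finset.prod_eq_zero (Finset.mem_univ w) (Matrix.one_apply_ne hw)
    have h2 : (phaser G φ hφ (γ (Fin.last p)))ᴴ * phaser G φ hφ (γ (Fin.last p)) = 1 := by
      rw [phaser_eq_diagonal, Matrix.diagonal_conjTranspose, Matrix.diagonal_mul_diagonal,
        ← Matrix.diagonal_one]
      congr 1
      ext x
      rw [Pi.star_apply, Complex.star_def, ← Complex.exp_conj, ← Complex.exp_add, ← Complex.exp_zero]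
      congr 1
      simp
    rw [qaoaState_succ, Matrix.star_mulVec, ← Matrix.dotProduct_mulVec, Matrix.mulVec_mulVec,
      Matrix.conjTranspose_mul, Matrix.mul_assoc, ← Matrix.mul_assoc _ᴴ (productOperator _ _) _, h1,
      Matrix.one_mul, h2, Matrix.one_mulVec]
    exact ih _ _ fun t => hB t.castSucc

/-- Labelings by ditstrings, split into their branches. -/
def splitBranches (V : Type*) (k p : ℕ) :
    (V → DitString k p) ≃ (V → Fin (p + 1) → Fin k) × (V → Fin (p + 1) → Fin k) :=
  (Equiv.arrowCongr (Equiv.refl V) DitString.branches).trans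
    (Equiv.arrowProdEquivProdArrow V (fun _ => Fin (p + 1) → Fin k) (fun _ => Fin (p + 1) → Fin k))

theorem splitBranches_apply (V : Type*) (k p : ℕ) (c : V → DitString k p) :
    splitBranches V k p c = (fun w => (c w).pos, fun w => (c w).neg) := rfl

/-- One path sum for the bra and one for the ket. Conjugation turns the phase of the bra into
`e^{+iγC}`, which is why `edgePhase` is a difference of two costs. -/
theorem expectation_diagonal (G : SimpleGraph V) [DecidableRel G.Adj] (γ : Fin p → ℝ)
    (B : Fin p → Matrix (Fin k) (Fin k) ℂ) (ψ : EuclideanSpace ℂ (Fin k)) (F : (V → Fin k) → ℂ) :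
    star (qaoaState G φ hφ γ B ψ) ⬝ᵥ (Matrix.diagonal F *ᵥ qaoaState G φ hφ γ B ψ) =
      ∑ c : V → DitString k p, (∏ w, weight B ψ (c w)) *
        (Complex.exp (Complex.I * ((∑ e ∈ G.edgeFinset, edgePhase φ hφ γ c e : ℝ) : ℂ)) *
          F fun w => (c w).pos (Fin.last p)) := by
  have hg : ∀ x, qaoaState G φ hφ γ B ψ x = ∑ a : V → Fin (p + 1) → Fin k,
      if (fun w => a w (Fin.last p)) = x then (∏ w, pathAmplitude B ψ (a w)) *
        Complex.exp (-(Complex.I *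
          ((∑ t : Fin p, γ t * cost G φ hφ (fun w => a w t.castSucc) : ℝ) : ℂ))) else 0 :=
    qaoaState_apply G γ B ψ
  generalize hgdef : (fun a : V → Fin (p + 1) → Fin k => (∏ w, pathAmplitude B ψ (a w)) *
        Complex.exp (-(Complex.I *
          ((∑ t : Fin p, γ t * cost G φ hφ (fun w => a w t.castSucc) : ℝ) : ℂ)))) = g
  have hg' : ∀ x, qaoaState G φ hφ γ B ψ x = ∑ a : V → Fin (p + 1) → Fin k,
      if (fun w => a w (Fin.last p)) = x then g a else 0 := by
    intro x
    rw [hg x, ← hgdef]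
  rw [← (splitBranches V k p).symm.sum_comp, Fintype.sum_prod_type]
  have lhs : star (qaoaState G φ hφ γ B ψ) ⬝ᵥ (Matrix.diagonal F *ᵥ qaoaState G φ hφ γ B ψ) =
      ∑ a : V → Fin (p + 1) → Fin k, star (g a) * F (fun w => a w (Fin.last p)) *
        ∑ b : V → Fin (p + 1) → Fin k,
          if (fun w => b w (Fin.last p)) = (fun w => a w (Fin.last p)) then g b else 0 := by
    simp only [dotProduct, Matrix.mulVec_diagonal, Pi.star_apply]
    have : ∀ x, star (qaoaState G φ hφ γ B ψ x) * (F x * qaoaState G φ hφ γ B ψ x) =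
        ∑ a : V → Fin (p + 1) → Fin k, if (fun w => a w (Fin.last p)) = x then
          star (g a) * F x * qaoaState G φ hφ γ B ψ x else 0 := by
      intro x
      have hs := congrArg star (hg' x)
      rw [star_sum] at hs
      rw [hs, Finset.sum_mul]
      refine Finset.sum_congr rfl fun a _ => ?_
      split_ifs
      · ring
      · simp
    simp only [this]
    rw [Finset.sum_comm]
    refine Finset.sum_congr rfl fun a _ => ?_
    rw [Finset.sum_ite_eq, if_pos (Finset.mem_univ _), hg']
  rw [lhs]
  refine Finset.sum_congr rfl fun a _ => ?_
  rw [Finset.mul_sum]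
  refine Finset.sum_congr rfl fun b _ => ?_
  obtain ⟨c, hc⟩ := (splitBranches V k p).surjective (a, b)
  rw [← hc, Equiv.symm_apply_apply]
  rw [splitBranches_apply] at hc
  obtain ⟨rfl, rfl⟩ := Prod.mk.inj hc
  simp only [weight_eq]
  split_ifs with h
  · have h' : ∀ w, (c w).pos (Fin.last p) = (c w).neg (Fin.last p) := fun w => (congrFun h w).symm
    simp only [h', if_true, Finset.prod_mul_distrib]
    rw [← hgdef, sum_edgePhase]
    simp only [star_mul', star_prod]
    rw [Complex.star_def, ← Complex.exp_conj]
    simp only [map_mul, map_neg, Complex.conj_I, Complex.conj_ofReal]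
    rw [Complex.ofReal_sub, mul_sub, sub_eq_add_neg, Complex.exp_add, neg_mul, neg_neg]
    ring
  -- If the two branches end differently at some vertex, then the indicator in the weight of that
  -- vertex vanishes.
  · obtain ⟨w, hw⟩ := Function.ne_iff.1 h
    rw [mul_zero, Finset.prod_eq_zero (Finset.mem_univ w) (if_neg (Ne.symm hw)), zero_mul]

/-- The sum is the squared norm of the QAOA state of a single vertex without edges. This
normalization is what lets vertices be summed out independently. -/
theorem sum_weight (B : Fin p → Matrix (Fin k) (Fin k) ℂ) (hB : ∀ t, (B t)ᴴ * B t = 1)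
    (ψ : EuclideanSpace ℂ (Fin k)) (hψ : ‖ψ‖ = 1) : ∑ a, weight B ψ a = 1 := by
  have h1 := star_dotProduct_qaoaState (φ := fun _ _ => 0) (hφ := fun _ _ => rfl)
    (⊥ : SimpleGraph Unit) 0 B hB ψ hψ
  have h2 := expectation_diagonal (φ := fun _ _ => 0) (hφ := fun _ _ => rfl)
    (⊥ : SimpleGraph Unit) 0 B ψ fun _ => 1
  rw [Matrix.diagonal_one, Matrix.one_mulVec, h1] at h2
  rw [h2, ← (Equiv.funUnique Unit (DitString k p)).symm.sum_comp]
  have h3 : ∀ (c : Unit → DitString k p) (e : Sym2 Unit),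
      edgePhase (fun _ _ => 0) (fun _ _ => rfl) (0 : Fin p → ℝ) c e = 0 := by
    intro c e
    induction e using Sym2.inductionOn with
    | hf a b => simp [edgePhase, phase]
  simp [h3]

end PathSum

/-! ## Summing out the vertices of a tree -/

section Resampling

variable {V X : Type*} [Fintype V] [DecidableEq V] [Fintype X]

/-- Adjoin an independent copy `b` of the label of `w`, at no cost since `f` sums to 1, and exchange
it with that label. Positivity of `f` plays no role. -/
theorem sum_resample (f : X → ℂ) (hf : ∑ b, f b = 1) (w : V) (F : (V → X) → ℂ) :
    ∑ c : V → X, (∏ u, f (c u)) * F c =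
      ∑ c : V → X, (∏ u, f (c u)) * ∑ b, f b * F (Function.update c w b) := by
  have hW : ∀ (c : V → X) (b : X),
      (∏ u, f (Function.update c w b u)) * f (c w) = (∏ u, f (c u)) * f b := by
    intro c b
    rw [← Finset.mul_prod_erase _ _ (Finset.mem_univ w),
      ← Finset.mul_prod_erase _ (fun u => f (c u)) (Finset.mem_univ w),
      Function.update_self]
    rw [Finset.prod_congr rfl fun u hu => by
      rw [Function.update_of_ne (Finset.ne_of_mem_erase hu)]]
    ring
  let σ : (V → X) × X ≃ (V → X) × X := Function.Involutive.toPerm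
    (fun q => (Function.update q.1 w q.2, q.1 w)) fun q => by
      simp
  calc ∑ c : V → X, (∏ u, f (c u)) * F c
      = ∑ q : (V → X) × X, (∏ u, f (q.1 u)) * f q.2 * F q.1 := by
        rw [Fintype.sum_prod_type]
        refine Finset.sum_congr rfl fun c _ => ?_
        simp only
        rw [← Finset.sum_mul, ← Finset.mul_sum, hf, mul_one]
    _ = ∑ q : (V → X) × X, (∏ u, f ((σ q).1 u)) * f (σ q).2 * F (σ q).1 := (σ.sum_comp _).symm
    _ = _ := by
        rw [Fintype.sum_prod_type]
        refine Finset.sum_congr rfl fun c _ => ?_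
        rw [Finset.mul_sum]
        refine Finset.sum_congr rfl fun b _ => ?_
        show (∏ u, f (Function.update c w b u)) * f (c w) * F (Function.update c w b) = _
        rw [hW, mul_assoc]

/-- The leaves are averaged one at a time by `sum_resample`. Since parents are not in `L`, changing
the label of one leaf affects no other factor. -/
theorem sum_leaves (f : X → ℂ) (hf : ∑ b, f b = 1) (h : X → X → ℂ) (π : V → V) (L : Finset V)
    (hπ : ∀ w ∈ L, π w ∉ L) (K : (V → X) → ℂ)
    (hK : ∀ w ∈ L, ∀ c b, K (Function.update c w b) = K c) :
    ∑ c : V → X, (∏ u, f (c u)) * (K c * ∏ w ∈ L, h (c (π w)) (c w)) =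
      ∑ c : V → X, (∏ u, f (c u)) * (K c * ∏ w ∈ L, ∑ b, f b * h (c (π w)) b) := by
  induction L using Finset.induction_on generalizing K with
  | empty => simp
  | insert w₀ L hw₀ ih =>
    have hπ₀ : π w₀ ≠ w₀ ∧ π w₀ ∉ L := by
      have := hπ w₀ (Finset.mem_insert_self _ _)
      rw [Finset.mem_insert, not_or] at this
      exact this
    have hπ' : ∀ w ∈ L, π w ≠ w₀ ∧ π w ∉ L := fun w hw => by
      have := hπ w (Finset.mem_insert_of_mem hw)
      rw [Finset.mem_insert, not_or] at this
      exact this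
    -- While the other leaves are summed out, the factor of `w₀` counts as part of the spectator
    -- `K`.
    have h1 := ih (fun w hw => (hπ' w hw).2) (fun c => K c * h (c (π w₀)) (c w₀)) (by
      intro w hw c b
      have hne : w₀ ≠ w := fun h => hw₀ (h ▸ hw)
      have hne' : π w₀ ≠ w := fun h => hπ₀.2 (h ▸ hw)
      simp only [hK w (Finset.mem_insert_of_mem hw), Function.update_of_ne hne,
        Function.update_of_ne hne'])
    simp only [Finset.prod_insert hw₀, ← mul_assoc] at h1 ⊢
    rw [h1]
    simp only [mul_assoc]
    rw [sum_resample f hf w₀]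
    refine Finset.sum_congr rfl fun c _ => ?_
    congr 1
    have h2 : ∀ b, ∏ w ∈ L, ∑ b', f b' * h (Function.update c w₀ b (π w)) b' =
        ∏ w ∈ L, ∑ b', f b' * h (c (π w)) b' := fun b =>
      Finset.prod_congr rfl fun w hw => by rw [Function.update_of_ne (hπ' w hw).1]
    simp only [h2, hK w₀ (Finset.mem_insert_self _ _), Function.update_of_ne hπ₀.1,
      Function.update_self]
    rw [Finset.sum_mul, Finset.mul_sum]
    exact Finset.sum_congr rfl fun b _ => by ring

theorem sum_pair (f : X → ℂ) (hf : ∑ b, f b = 1) {u v : V} (huv : u ≠ v) (F : X → X → ℂ) :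
    ∑ c : V → X, (∏ w, f (c w)) * F (c u) (c v) = ∑ a, ∑ b, f a * (f b * F a b) := by
  rw [sum_resample f hf u]
  simp only [Function.update_self, Function.update_of_ne huv.symm]
  rw [sum_resample f hf v]
  simp only [Function.update_self]
  rw [← Finset.sum_mul, ← Fintype.prod_sum fun (_ : V) b => f b, hf, Finset.prod_const_one,
    one_mul]
  simp only [Finset.mul_sum]
  rw [Finset.sum_comm]
  exact Finset.sum_congr rfl fun _ _ => Finset.sum_congr rfl fun _ _ => by ring

end Resampling

/-! ### The tree around the edge, peeled sphere by sphere. -/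

section Tree

variable {V : Type*} [Fintype V] [DecidableEq V] {G : SimpleGraph V} [DecidableRel G.Adj]
  {u v : V}

/-- The edges of the tree of depth `r` that grows from the edge `{u, v}`. -/
def treeEdges (G : SimpleGraph V) [DecidableRel G.Adj] (u v : V) : ℕ → Finset (Sym2 V)
  | 0 => {s(u, v)}
  | r + 1 => G.edgeFinset.filter fun e => ∃ a ∈ ball G {u, v} r, a ∈ e

theorem mem_ball_of_mem_treeEdges {r : ℕ} {e : Sym2 V} (he : e ∈ treeEdges G u v r) {a : V}
    (ha : a ∈ e) : a ∈ ball G {u, v} r := by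
  cases r with
  | zero =>
    rw [treeEdges, Finset.mem_singleton] at he
    subst he
    simpa [ball_zero] using ha
  | succ r =>
    rw [treeEdges, Finset.mem_filter, SimpleGraph.mem_edgeFinset] at he
    obtain ⟨he, b, hb, hbe⟩ := he
    obtain ⟨x, rfl⟩ := Sym2.mem_iff_exists.1 hbe
    rcases Sym2.mem_iff.1 ha with rfl | rfl
    · exact mem_ball_succ.2 (Or.inl hb)
    · exact mem_ball_succ.2 (Or.inr ⟨b, hb, he⟩)

/-- A new edge either leads from the ball to the new sphere, and then joins a vertex to its unique
parent, or lies inside the ball; in the latter case `not_adj_of_mem_sphere` shows that it was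
already present. -/
theorem treeEdges_succ {p : ℕ} (huv : G.Adj u v) (hg : ((2 * p + 2 : ℕ) : ℕ∞) ≤ G.egirth)
    {r : ℕ} (hr : r + 1 ≤ p) {π : V → V}
    (hπ : ∀ w ∈ sphere G {u, v} (r + 1), ∀ y, y ∈ ball G {u, v} r ∧ G.Adj y w ↔ y = π w) :
    treeEdges G u v (r + 1) =
      treeEdges G u v r ∪ (sphere G {u, v} (r + 1)).image fun w => s(π w, w) := by
  ext e
  rw [Finset.mem_union, Finset.mem_image]
  constructor
  · intro he
    rw [treeEdges, Finset.mem_filter, SimpleGraph.mem_edgeFinset] at he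
    obtain ⟨he, a, ha, hae⟩ := he
    obtain ⟨b, rfl⟩ := Sym2.mem_iff_exists.1 hae
    rw [SimpleGraph.mem_edgeSet] at he
    by_cases hb : b ∈ ball G {u, v} r
    · left
      cases r with
      | zero =>
        simp only [ball_zero, Finset.mem_insert, Finset.mem_singleton] at ha hb
        rw [treeEdges, Finset.mem_singleton]
        rcases ha with rfl | rfl <;> rcases hb with rfl | rfl
        · exact absurd rfl he.ne
        · rfl
        · exact Sym2.eq_swap
        · exact absurd rfl he.ne
      | succ r =>
        rw [treeEdges, Finset.mem_filter, SimpleGraph.mem_edgeFinset]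
        refine ⟨he, ?_⟩
        by_cases ha' : a ∈ ball G {u, v} r
        · exact ⟨a, ha', Sym2.mem_mk_left a b⟩
        by_cases hb' : b ∈ ball G {u, v} r
        · exact ⟨b, hb', Sym2.mem_mk_right a b⟩
        exact absurd he (not_adj_of_mem_sphere huv hg (by omega) ha hb ha' hb')
    · right
      have hbs : b ∈ sphere G {u, v} (r + 1) :=
        Finset.mem_sdiff.2 ⟨mem_ball_succ.2 (Or.inr ⟨a, ha, he⟩), hb⟩
      exact ⟨b, hbs, by rw [← (hπ b hbs a).1 ⟨ha, he⟩]⟩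
  · rintro (he | ⟨w, hw, rfl⟩)
    · rw [treeEdges, Finset.mem_filter]
      cases r with
      | zero =>
        rw [treeEdges, Finset.mem_singleton] at he
        subst he
        exact ⟨SimpleGraph.mem_edgeFinset.2 huv, u, by simp [ball_zero], Sym2.mem_mk_left u v⟩
      | succ r =>
        rw [treeEdges, Finset.mem_filter] at he
        obtain ⟨he, a, ha, hae⟩ := he
        exact ⟨he, a, ball_mono _ r.le_succ ha, hae⟩
    · have h := (hπ w hw (π w)).2 rfl
      rw [treeEdges, Finset.mem_filter, SimpleGraph.mem_edgeFinset]
      exact ⟨h.2, π w, h.1, Sym2.mem_mk_left _ _⟩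

theorem sum_treeEdges_succ {p : ℕ} (huv : G.Adj u v) (hg : ((2 * p + 2 : ℕ) : ℕ∞) ≤ G.egirth)
    {r : ℕ} (hr : r + 1 ≤ p) {π : V → V}
    (hπ : ∀ w ∈ sphere G {u, v} (r + 1), ∀ y, y ∈ ball G {u, v} r ∧ G.Adj y w ↔ y = π w)
    (F : Sym2 V → ℝ) :
    ∑ e ∈ treeEdges G u v (r + 1), F e =
      ∑ e ∈ treeEdges G u v r, F e + ∑ w ∈ sphere G {u, v} (r + 1), F s(π w, w) := by
  have hnot : ∀ w ∈ sphere G {u, v} (r + 1), w ∉ ball G {u, v} r := fun w hw =>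
    (Finset.mem_sdiff.1 hw).2
  rw [treeEdges_succ huv hg hr hπ, Finset.sum_union, Finset.sum_image]
  · intro w hw w' hw' h
    rcases Sym2.eq_iff.1 h with ⟨-, h⟩ | ⟨-, h⟩
    · exact h
    · exact absurd (h ▸ ((hπ w' hw' (π w')).2 rfl).1) (hnot w hw)
  · rw [Finset.disjoint_left]
    intro e he he'
    obtain ⟨w, hw, rfl⟩ := Finset.mem_image.1 he'
    exact hnot w hw (mem_ball_of_mem_treeEdges he (Sym2.mem_mk_right _ _))

variable {k p d : ℕ} {φ : Fin k → Fin k → ℝ} {hφ : ∀ a b, φ a b = φ b a}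

/-- The sum over the labelings of a tree of depth `r` whose branches below depth `r` are
summed out. -/
def treeSum (G : SimpleGraph V) [DecidableRel G.Adj] (u v : V) (φ : Fin k → Fin k → ℝ)
    (hφ : ∀ a b, φ a b = φ b a) (γ : Fin p → ℝ) (B : Fin p → Matrix (Fin k) (Fin k) ℂ)
    (ψ : EuclideanSpace ℂ (Fin k)) (d : ℕ) (ξ : Fin k → Fin k → ℝ) (r m : ℕ) : ℂ :=
  ∑ c : V → DitString k p, (∏ w, weight B ψ (c w)) *
    (Complex.exp (Complex.I * ((∑ e ∈ treeEdges G u v r, edgePhase φ hφ γ c e : ℝ) : ℂ)) *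
      (ξ ((c u).pos (Fin.last p)) ((c v).pos (Fin.last p)) : ℂ) *
      ∏ w ∈ sphere G {u, v} r, branchTensor φ γ B ψ d m (c w))

/-- The vertices of the outermost sphere are leaves attached to their parents, and `sum_leaves`
removes them. A vertex of the previous sphere collects the same factor from each of its `d`
children, which is exactly the next branch tensor. -/
theorem treeSum_succ (hd : G.IsRegularOfDegree (d + 1)) (huv : G.Adj u v)
    (hg : ((2 * p + 2 : ℕ) : ℕ∞) ≤ G.egirth) (γ : Fin p → ℝ)
    (B : Fin p → Matrix (Fin k) (Fin k) ℂ) (ψ : EuclideanSpace ℂ (Fin k))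
    (hw : ∑ a, weight B ψ a = 1) (ξ : Fin k → Fin k → ℝ) {r : ℕ} (hr : r + 1 ≤ p) (m : ℕ) :
    treeSum G u v φ hφ γ B ψ d ξ (r + 1) m = treeSum G u v φ hφ γ B ψ d ξ r (m + 1) := by
  have hex : ∀ w, ∃ x, w ∈ sphere G {u, v} (r + 1) →
      ∀ y, y ∈ ball G {u, v} r ∧ G.Adj y w ↔ y = x := by
    intro w
    by_cases hws : w ∈ sphere G {u, v} (r + 1)
    · obtain ⟨hw1, hw2⟩ := Finset.mem_sdiff.1 hws
      obtain ⟨x, hx, hxw⟩ := (mem_ball_succ.1 hw1).resolve_left hw2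
      refine ⟨x, fun _ y => ⟨fun h => eq_of_adj_ball huv hg hr hw2 h.1 hx h.2 hxw, ?_⟩⟩
      rintro rfl
      exact ⟨hx, hxw⟩
    · exact ⟨w, fun h => absurd h hws⟩
  choose π hπ using hex
  have hnot : ∀ w ∈ sphere G {u, v} (r + 1), w ∉ ball G {u, v} r := fun w hw =>
    (Finset.mem_sdiff.1 hw).2
  have hπb : ∀ w ∈ sphere G {u, v} (r + 1), π w ∈ ball G {u, v} r ∧ G.Adj (π w) w :=
    fun w hw => (hπ w hw (π w)).2 rfl
  have hub : u ∈ ball G {u, v} r := ball_mono _ (Nat.zero_le r) (by simp [ball_zero])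
  have hvb : v ∈ ball G {u, v} r := ball_mono _ (Nat.zero_le r) (by simp [ball_zero])
  have hL := sum_leaves (weight B ψ) hw
    (fun x b => branchTensor φ γ B ψ d m b * Complex.exp (Complex.I * (phase φ γ x b : ℂ))) π
    (sphere G {u, v} (r + 1)) (fun w hw h => hnot _ h (hπb w hw).1)
    (fun c => Complex.exp (Complex.I *
      ((∑ e ∈ treeEdges G u v r, edgePhase φ hφ γ c e : ℝ) : ℂ)) *
      (ξ ((c u).pos (Fin.last p)) ((c v).pos (Fin.last p)) : ℂ)) (by
    intro w hw c b
    have hne : ∀ x ∈ ball G {u, v} r, Function.update c w b x = c x := fun x hx =>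
      Function.update_of_ne (by rintro rfl; exact hnot x hw hx) _ _
    rw [hne u hub, hne v hvb]
    congr 4
    refine Finset.sum_congr rfl fun e he => ?_
    have hmem := fun a => mem_ball_of_mem_treeEdges (a := a) he
    induction e using Sym2.inductionOn with
    | hf x y =>
      simp only [edgePhase, Sym2.lift_mk]
      rw [hne x (hmem x (Sym2.mem_mk_left x y)), hne y (hmem y (Sym2.mem_mk_right x y))])
  rw [treeSum, treeSum]
  refine Eq.trans (Finset.sum_congr rfl fun c _ => ?_) (hL.trans
    (Finset.sum_congr rfl fun c _ => ?_))
  · rw [sum_treeEdges_succ huv hg hr hπ, Finset.prod_mul_distrib, ← Complex.exp_sum,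
      ← Finset.mul_sum, Complex.ofReal_add, mul_add, Complex.exp_add]
    simp only [edgePhase, Sym2.lift_mk, Complex.ofReal_sum]
    ring
  · congr 2
    -- The factors are grouped by parent; `card_children` counts each group.
    rw [← Finset.prod_fiberwise_of_maps_to (s := sphere G {u, v} (r + 1))
      (t := sphere G {u, v} r) (g := π)
      fun w hw => mem_sphere_of_adj_sphere_succ (hπb w hw).1 hw (hπb w hw).2]
    refine Finset.prod_congr rfl fun y hy => ?_
    have hcard : ((sphere G {u, v} (r + 1)).filter fun w => π w = y).card = d := by
      rw [← card_children hd huv hg hr hy]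
      congr 1
      refine Finset.filter_congr fun w hw => ?_
      rw [eq_comm, ← hπ w hw y]
      exact and_iff_right (sphere_subset_ball _ _ hy)
    rw [Finset.prod_congr rfl fun w hw => by rw [(Finset.mem_filter.1 hw).2], Finset.prod_const,
      hcard, branchTensor]
    simp only [mul_assoc]

theorem treeSum_zero (huv : G.Adj u v) (γ : Fin p → ℝ)
    (B : Fin p → Matrix (Fin k) (Fin k) ℂ) (ψ : EuclideanSpace ℂ (Fin k))
    (hw : ∑ a, weight B ψ a = 1) (ξ : Fin k → Fin k → ℝ) :
    treeSum G u v φ hφ γ B ψ d ξ 0 p = edgeValue φ γ B ψ d ξ := by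
  rw [treeSum, edgeValue]
  simp only [treeEdges, sphere, Finset.sum_singleton, Finset.prod_pair huv.ne, edgePhase,
    Sym2.lift_mk]
  rw [sum_pair (weight B ψ) hw huv.ne fun a b =>
    Complex.exp (Complex.I * (phase φ γ a b : ℂ)) *
      (ξ (a.pos (Fin.last p)) (b.pos (Fin.last p)) : ℂ) *
      (branchTensor φ γ B ψ d p a * branchTensor φ γ B ψ d p b)]
  exact Finset.sum_congr rfl fun _ _ => Finset.sum_congr rfl fun _ _ => by ring

theorem treeSum_eq_edgeValue (hd : G.IsRegularOfDegree (d + 1)) (huv : G.Adj u v)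
    (hg : ((2 * p + 2 : ℕ) : ℕ∞) ≤ G.egirth) (γ : Fin p → ℝ)
    (B : Fin p → Matrix (Fin k) (Fin k) ℂ) (ψ : EuclideanSpace ℂ (Fin k))
    (hw : ∑ a, weight B ψ a = 1) (ξ : Fin k → Fin k → ℝ) {r m : ℕ} (hr : r + m = p) :
    treeSum G u v φ hφ γ B ψ d ξ r m = edgeValue φ γ B ψ d ξ := by
  induction r generalizing m with
  | zero =>
    rw [zero_add] at hr
    subst hr
    exact treeSum_zero huv γ B ψ hw ξ
  | succ r ih =>
    rw [treeSum_succ hd huv hg γ B ψ hw ξ (by omega)]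
    exact ih (by omega)

theorem edgeExpectation_eq_edgeValue (hd : G.IsRegularOfDegree (d + 1)) (huv : G.Adj u v)
    (hg : ((2 * p + 2 : ℕ) : ℕ∞) ≤ G.egirth) (γ : Fin p → ℝ)
    (B : Fin p → Matrix (Fin k) (Fin k) ℂ) (hB : ∀ t, (B t)ᴴ * B t = 1)
    (ψ : EuclideanSpace ℂ (Fin k)) (hψ : ‖ψ‖ = 1) (ξ : Fin k → Fin k → ℝ) :
    edgeExpectation G φ hφ γ B ψ ξ u v = edgeValue φ γ B ψ d ξ := by
  have hw := sum_weight B hB ψ hψ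
  -- The full depth `r = p` with `m = 0`: the tensors on the outermost sphere are still 1.
  rw [← treeSum_eq_edgeValue (hφ := hφ) hd huv hg γ B ψ hw ξ (Nat.add_zero p), treeSum]
  simp only [branchTensor, Finset.prod_const_one, mul_one]
  cases p with
  | zero =>
    -- With no layers there are no phases, so it is harmless that `treeEdges` contains the central
    -- edge although the light cone contains none.
    have h0 : ∀ (c : V → DitString k 0) (e : Sym2 V), edgePhase φ hφ γ c e = 0 := by
      intro c e
      induction e using Sym2.inductionOn with
      | hf a b => simp [edgePhase, phase]
    rw [edgeExpectation, edgeObservable, expectation_diagonal]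
    simp only [h0, Finset.sum_const_zero]
  | succ p =>
    let H : SimpleGraph V :=
      { Adj := fun a b => G.Adj a b ∧ (a ∈ ball G {u, v} p ∨ b ∈ ball G {u, v} p)
        symm := ⟨fun a b h => ⟨h.1.symm, h.2.symm⟩⟩
        loopless := ⟨fun a h => h.1.ne rfl⟩ }
    have : DecidableRel H.Adj := fun a b => inferInstanceAs (Decidable (_ ∧ _))
    have hE : H.edgeFinset = treeEdges G u v (p + 1) := by
      ext e
      rw [treeEdges, Finset.mem_filter, SimpleGraph.mem_edgeFinset, SimpleGraph.mem_edgeFinset]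
      induction e using Sym2.inductionOn with
      | hf a b =>
        rw [SimpleGraph.mem_edgeSet, SimpleGraph.mem_edgeSet]
        refine and_congr_right fun _ => ⟨?_, ?_⟩
        · rintro (h | h)
          · exact ⟨a, h, Sym2.mem_mk_left a b⟩
          · exact ⟨b, h, Sym2.mem_mk_right a b⟩
        · rintro ⟨x, hx, hxe⟩
          rcases Sym2.mem_iff.1 hxe with rfl | rfl
          · exact Or.inl hx
          · exact Or.inr hx
    rw [edgeExpectation, expectation_congr_of_ball (H := H) γ B hB ψ {u, v}
      (fun j hj a ha b => ⟨fun h => ⟨h, Or.inl (ball_mono _ (by omega) ha)⟩, fun h => h.1⟩) _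
      (supportedOn_edgeObservable ξ u v), edgeObservable, expectation_diagonal, hE]

end Tree

/-! ## Reasoning about programs -/

section Machine

/-- Started in `s`, the program `P` stops after at most `T` steps, in a store that satisfies `Q`. -/
def Prog.Runs (S : ℕ) (inp : Input) (P : Prog) (T : ℕ) (s : Store) (Q : Store → Prop) : Prop :=
  ∃ (s' : Store) (t : ℕ), P.exec S inp s = some (s', t) ∧ t ≤ T ∧ Q s'

variable {S : ℕ} {inp : Input}

theorem Prog.Runs.mono {P : Prog} {T T' : ℕ} {s : Store} {Q Q' : Store → Prop}
    (h : P.Runs S inp T s Q) (hT : T ≤ T') (hQ : ∀ s', Q s' → Q' s') : P.Runs S inp T' s Q' := by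
  obtain ⟨s', t, h1, h2, h3⟩ := h
  exact ⟨s', t, h1, h2.trans hT, hQ s' h3⟩

theorem Prog.Runs.seq {P P' : Prog} {T T' : ℕ} {s : Store} {Q R : Store → Prop}
    (h : P.Runs S inp T s Q) (h' : ∀ s', Q s' → P'.Runs S inp T' s' R) :
    (Prog.seq P P').Runs S inp (T + T') s R := by
  obtain ⟨s', t, h1, h2, h3⟩ := h
  obtain ⟨s'', t', h1', h2', h3'⟩ := h' s' h3
  exact ⟨s'', t + t', by simp [Prog.exec, h1, h1'], by omega, h3'⟩

theorem Prog.Runs.ifEq {P P' : Prog} {T : ℕ} {s : Store} {R : Store → Prop} {i j : ℕ}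
    (h : s.reg i = s.reg j → P.Runs S inp T s R) (h' : s.reg i ≠ s.reg j → P'.Runs S inp T s R) :
    (Prog.ifEq i j P P').Runs S inp (T + 1) s R := by
  by_cases hij : s.reg i = s.reg j
  · obtain ⟨s', t, h1, h2, h3⟩ := h hij
    exact ⟨s', t + 1, by simp [Prog.exec, hij, h1], by omega, h3⟩
  · obtain ⟨s', t, h1, h2, h3⟩ := h' hij
    exact ⟨s', t + 1, by simp [Prog.exec, hij, h1], by omega, h3⟩

/-- The invariant is required before the counter is overwritten, because every round sets the
counter afresh whatever the body did to it. -/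
theorem Prog.Runs.loop {P : Prog} {T : ℕ} {s : Store} {i j n : ℕ} (hn : s.reg j = n)
    (I : ℕ → Store → Prop) (h0 : I 0 s)
    (hstep : ∀ t < n, ∀ s', I t s' →
      P.Runs S inp T { s' with reg := Function.update s'.reg i t } (I (t + 1))) :
    (Prog.loop i j P).Runs S inp (1 + n * (1 + T)) s (I n) := by
  have key : ∀ m ≤ n, ∃ (s' : Store) (t : ℕ),
      iterate (P.exec S inp) i m s = some (s', t) ∧ t ≤ 1 + m * (1 + T) ∧ I m s' := by
    intro m
    induction m with
    | zero => exact fun _ => ⟨s, 1, rfl, by omega, h0⟩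
    | succ m ih =>
      intro hm
      obtain ⟨s', t, h1, h2, h3⟩ := ih (by omega)
      obtain ⟨s'', t', h1', h2', h3'⟩ := hstep m (by omega) s' h3
      refine ⟨s'', t + 1 + t', by simp [iterate, h1, h1'], ?_, h3'⟩
      rw [Nat.add_mul, one_mul]
      omega
  obtain ⟨s', t, h1, h2, h3⟩ := key n le_rfl
  exact ⟨s', t, by rw [Prog.exec, hn, h1], h2, h3⟩

/-- A sequence of instructions. -/
def Prog.block : Instr → List Instr → Prog
  | c, [] => Prog.instr c
  | c, c' :: cs => Prog.seq (Prog.instr c) (Prog.block c' cs)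

/-- The sequence of instructions can be executed, and establishes `Q`. -/
def Establishes (S : ℕ) (inp : Input) (Q : Store → Prop) : List Instr → Store → Prop
  | [], s => Q s
  | c :: cs, s => ∃ s', c.exec S inp s = some s' ∧ Establishes S inp Q cs s'

theorem Prog.runs_block {c : Instr} {cs : List Instr} {s : Store} {Q : Store → Prop}
    (h : Establishes S inp Q (c :: cs) s) :
    (Prog.block c cs).Runs S inp (cs.length + 1) s Q := by
  induction cs generalizing c s with
  | nil =>
    obtain ⟨s', h1, h2⟩ := h
    exact ⟨s', 1, by simp [Prog.block, Prog.exec, h1], le_rfl, h2⟩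
  | cons c' cs ih =>
    obtain ⟨s', h1, h2⟩ := h
    obtain ⟨s'', t, h3, h4, h5⟩ := ih h2
    refine ⟨s'', 1 + t, by simp [Prog.block, Prog.exec, h1, h3], ?_, h5⟩
    rw [List.length_cons]
    omega

section Instructions

variable {Q : Store → Prop} {cs : List Instr} {r : ℕ → ℕ} {m : ℕ → ℂ}

/-- Together with the following equivalences this executes a block symbolically: `simp` turns it
into a list of bounds on addresses and register values, followed by the postcondition for the
updated store. -/
theorem establishes_nil : Establishes S inp Q [] ⟨r, m⟩ ↔ Q ⟨r, m⟩ := Iff.rfl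

theorem establishes_const {i c : ℕ} : Establishes S inp Q (.const i c :: cs) ⟨r, m⟩ ↔
    c < S ∧ Establishes S inp Q cs ⟨Function.update r i c, m⟩ := by
  by_cases h : c < S <;> simp [Establishes, Instr.exec, Store.setReg, h]

theorem establishes_param {i n : ℕ} : Establishes S inp Q (.param i n :: cs) ⟨r, m⟩ ↔
    inp.param n < S ∧ Establishes S inp Q cs ⟨Function.update r i (inp.param n), m⟩ := by
  by_cases h : inp.param n < S <;> simp [Establishes, Instr.exec, Store.setReg, h]

theorem establishes_index {o : IndexOp} {i j l : ℕ} :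
    Establishes S inp Q (.index o i j l :: cs) ⟨r, m⟩ ↔
    o.eval (r j) (r l) < S ∧
      Establishes S inp Q cs ⟨Function.update r i (o.eval (r j) (r l)), m⟩ := by
  by_cases h : o.eval (r j) (r l) < S <;> simp [Establishes, Instr.exec, Store.setReg, h]

theorem establishes_cellConst {c : CellConst} {i : ℕ} :
    Establishes S inp Q (.cellConst c i :: cs) ⟨r, m⟩ ↔
    r i < S ∧ Establishes S inp Q cs ⟨r, Function.update m (r i) c.eval⟩ := by
  by_cases h : r i < S <;> simp [Establishes, Instr.exec, Store.put, h]

theorem establishes_read {i a j : ℕ} : Establishes S inp Q (.read i a j :: cs) ⟨r, m⟩ ↔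
    r i < S ∧ Establishes S inp Q cs ⟨r, Function.update m (r i) (inp.data a (r j))⟩ := by
  by_cases h : r i < S <;> simp [Establishes, Instr.exec, Store.put, h]

theorem establishes_cellFun {g : CellFun} {i j : ℕ} :
    Establishes S inp Q (.cellFun g i j :: cs) ⟨r, m⟩ ↔
    r j < S ∧ r i < S ∧
      Establishes S inp Q cs ⟨r, Function.update m (r i) (g.eval inp (m (r j)))⟩ := by
  by_cases h : r j < S <;> by_cases h' : r i < S <;>
    simp [Establishes, Instr.exec, Store.put, Store.get, h, h']

theorem establishes_cellOp {o : CellOp} {i j l : ℕ} :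
    Establishes S inp Q (.cellOp o i j l :: cs) ⟨r, m⟩ ↔
    r j < S ∧ r l < S ∧ r i < S ∧
      Establishes S inp Q cs ⟨r, Function.update m (r i) (o.eval (m (r j)) (m (r l)))⟩ := by
  by_cases h : r j < S <;> by_cases h' : r l < S <;> by_cases h'' : r i < S <;>
    simp [Establishes, Instr.exec, Store.put, Store.get, h, h', h'']

end Instructions

/-- `s'` agrees with `s` on the registers below `r` and on the cells from `m` on. -/
def Agree (r m : ℕ) (s s' : Store) : Prop :=
  (∀ i < r, s'.reg i = s.reg i) ∧ ∀ a, m ≤ a → s'.mem a = s.mem a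

theorem Agree.refl (r m : ℕ) (s : Store) : Agree r m s s := ⟨fun _ _ => rfl, fun _ _ => rfl⟩

theorem Agree.trans {r m r' m' r'' m'' : ℕ} {s s' s'' : Store} (h : Agree r m s s')
    (h' : Agree r' m' s' s'') (hr : r'' ≤ r) (hr' : r'' ≤ r') (hm : m ≤ m'') (hm' : m' ≤ m'') :
    Agree r'' m'' s s'' :=
  ⟨fun i hi => (h'.1 i (by omega)).trans (h.1 i (by omega)),
    fun a ha => (h'.2 a (by omega)).trans (h.2 a (by omega))⟩

/-- Repeat `body`, which leaves a term in cell `0`, and accumulate the terms in cell `3`. The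
number of rounds is in register `j`, the counter is register `14`; registers `8` and `11` hold the
addresses `0` and `3`. -/
def Prog.accumulate (o : CellOp) (j : ℕ) (body : Prog) : Prog :=
  .loop 14 j (.seq body (.instr (.cellOp o 11 11 8)))

/-- The relation `R` tracks registers `15` and `16`, which a body may consume from round to round,
for instance by dividing off base-`k` digits. The frame condition on the body protects the counter
and the accumulator. -/
theorem Prog.runs_accumulate {o : CellOp} {j n T : ℕ} {body : Prog} {s : Store} (hS : 3 < S)
    (hn : s.reg j = n) (h8 : s.reg 8 = 0) (h11 : s.reg 11 = 3) (v acc : ℕ → ℂ)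
    (hacc0 : acc 0 = s.mem 3) (hacc : ∀ t < n, acc (t + 1) = o.eval (acc t) (v t))
    (R : ℕ → ℕ → ℕ → Prop) (hR : R 0 (s.reg 15) (s.reg 16))
    (hbody : ∀ t < n, ∀ s', Agree 14 4 s s' → s'.reg 14 = t → R t (s'.reg 15) (s'.reg 16) →
      body.Runs S inp T s' fun s'' => Agree 15 3 s' s'' ∧ s''.mem 0 = v t ∧
        R (t + 1) (s''.reg 15) (s''.reg 16)) :
    (Prog.accumulate o j body).Runs S inp (1 + n * (2 + T)) s fun s' =>
      Agree 14 4 s s' ∧ R n (s'.reg 15) (s'.reg 16) ∧ s'.mem 3 = acc n := by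
  have h := Prog.Runs.loop (S := S) (inp := inp) (T := T + 1) (i := 14) (j := j) hn
    (P := .seq body (.instr (.cellOp o 11 11 8)))
    (fun t s' => Agree 14 4 s s' ∧ R t (s'.reg 15) (s'.reg 16) ∧ s'.mem 3 = acc t)
    ⟨Agree.refl _ _ _, hR, hacc0.symm⟩ ?_
  · refine h.mono (le_of_eq ?_) fun _ h => h
    ring
  rintro t ht s' ⟨hA, hRt, h3⟩
  have hA' : Agree 14 4 s { s' with reg := Function.update s'.reg 14 t } :=
    ⟨fun i hi => by rw [← hA.1 i hi]; exact Function.update_of_ne (by omega) _ _, hA.2⟩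
  refine (hbody t ht { s' with reg := Function.update s'.reg 14 t } hA' (by simp)
    (by simpa using hRt)).seq fun s'' hs'' => ?_
  obtain ⟨hB, hv, hR'⟩ := hs''
  have hB8 : s''.reg 8 = 0 := by rw [hB.1 8 (by norm_num), hA'.1 8 (by norm_num), h8]
  have hB11 : s''.reg 11 = 3 := by rw [hB.1 11 (by norm_num), hA'.1 11 (by norm_num), h11]
  have hB3 : s''.mem 3 = acc t := (hB.2 3 le_rfl).trans h3
  refine Prog.runs_block (c := .cellOp o 11 11 8) (cs := []) ?_
  obtain ⟨r'', m''⟩ := s''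
  simp only at hB8 hB11 hB3 hv hR'
  rw [establishes_cellOp, establishes_nil, hB11, hB8]
  refine ⟨hS, by omega, hS, ?_, hR', ?_⟩
  · have h4 := hA'.trans hB (r'' := 14) (m'' := 4) (by norm_num) (by norm_num) (by norm_num)
      (by norm_num)
    refine ⟨h4.1, fun a ha => ?_⟩
    rw [← h4.2 a ha]
    exact Function.update_of_ne (by omega) _ _
  · simp only [Function.update_self]
    rw [hB3, hv, hacc t ht]

/-- Run `body`, which leaves a value in cell `3`, and copy that value to the array whose base
address is in register `b`. The number of entries is in register `j`, the counter is register
`13`. -/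
def Prog.fill (j b : ℕ) (body : Prog) : Prog :=
  .loop 13 j (.seq body (.block (.index .add 14 b 13) [.cellFun .copy 14 11]))

/-- `s'` agrees with `s` on the registers below `13` and outside of the cells below `4` and of
the array of length `n` at `b`. -/
def AgreeOff (b n : ℕ) (s s' : Store) : Prop :=
  (∀ i < 13, s'.reg i = s.reg i) ∧ ∀ a, 4 ≤ a → (a < b ∨ b + n ≤ a) → s'.mem a = s.mem a

/-- The array starts beyond the four scratch cells. Entries already written survive because the body
leaves all cells from `4` on alone. -/
theorem Prog.runs_fill {j b n base T : ℕ} {body : Prog} {s : Store} (hS : base + n ≤ S)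
    (hbase : 4 ≤ base) (hb : b < 13) (hn : s.reg j = n) (hbb : s.reg b = base)
    (h11 : s.reg 11 = 3) (v : ℕ → ℂ)
    (hbody : ∀ t < n, ∀ s', AgreeOff base n s s' → s'.reg 13 = t →
      body.Runs S inp T s' fun s'' => Agree 14 4 s' s'' ∧ s''.mem 3 = v t) :
    (Prog.fill j b body).Runs S inp (1 + n * (3 + T)) s fun s' =>
      AgreeOff base n s s' ∧ ∀ t < n, s'.mem (base + t) = v t := by
  have h := Prog.Runs.loop (S := S) (inp := inp) (T := T + 2) (i := 13) (j := j) hn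
    (P := .seq body (.block (.index .add 14 b 13) [.cellFun .copy 14 11]))
    (fun t s' => AgreeOff base n s s' ∧ ∀ t' < t, s'.mem (base + t') = v t')
    ⟨⟨fun _ _ => rfl, fun _ _ _ => rfl⟩, fun t ht => absurd ht (Nat.not_lt_zero t)⟩ ?_
  · refine h.mono (le_of_eq ?_) fun _ h => h
    ring
  rintro t ht s' ⟨hA, hv⟩
  have hA' : AgreeOff base n s { s' with reg := Function.update s'.reg 13 t } :=
    ⟨fun i hi => by rw [← hA.1 i hi]; exact Function.update_of_ne (by omega) _ _, hA.2⟩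
  refine (hbody t ht { s' with reg := Function.update s'.reg 13 t } hA' (by simp)).seq
    fun s'' hs'' => ?_
  obtain ⟨hB, h3⟩ := hs''
  have hB13 : s''.reg 13 = t := by rw [hB.1 13 (by norm_num)]; simp
  have hBb : s''.reg b = base := by rw [hB.1 b (by omega), hA'.1 b hb, hbb]
  have hB11 : s''.reg 11 = 3 := by rw [hB.1 11 (by norm_num), hA'.1 11 (by norm_num), h11]
  refine Prog.runs_block ?_
  obtain ⟨r'', m''⟩ := s''
  simp only at hB13 hBb hB11 h3
  rw [establishes_index, establishes_cellFun, establishes_nil]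
  simp only [hB13, hBb, IndexOp.eval, Function.update_self, CellFun.eval]
  rw [Function.update_of_ne (by norm_num : (11 : ℕ) ≠ 14), hB11, h3]
  refine ⟨by omega, by omega, by omega, ⟨fun i hi => ?_, fun a ha ha' => ?_⟩, fun t' ht' => ?_⟩
  · rw [← hA'.1 i hi, ← hB.1 i (by omega)]
    exact Function.update_of_ne (by omega) _ _
  · rw [← hA'.2 a ha ha', ← hB.2 a ha]
    exact Function.update_of_ne (by omega) _ _
  · by_cases htt : t' = t
    · subst htt
      exact Function.update_self ..
    · refine (Function.update_of_ne (by omega) _ _).trans ?_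
      exact (hB.2 _ (by omega)).trans (hv t' (by omega))

end Machine

/-! ## The evaluation program -/

section Program

open Prog

/-- Digit `t` of `x` in base `k`. -/
def digit (k x t : ℕ) : ℕ := x / k ^ t % k

/-- The weight of the ditstring with branches `x` and `y`, in terms of the input. -/
def weightEntry (inp : Input) (k p x y : ℕ) : ℂ :=
  if x / k ^ p = y / k ^ p then
    (star (inp.data 4 (x % k)) * inp.data 4 (y % k)) * ∏ t ∈ Finset.range p,
      (star (inp.data 3 ((t * k + digit k x (t + 1)) * k + digit k x t)) *
        inp.data 3 ((t * k + digit k y (t + 1)) * k + digit k y t))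
  else 0

/-- The factor of the phase contributed by one branch, in terms of the input. -/
def phaseEntry (inp : Input) (k p x x' : ℕ) : ℂ :=
  Complex.exp ((∑ t ∈ Finset.range p,
    inp.data 0 (digit k x t * k + digit k x' t) * inp.data 2 t) * Complex.I)

/-- The contents of the index registers after the initialization. -/
def Ready (k p : ℕ) (s : Store) : Prop :=
  s.reg 0 = k ∧ s.reg 1 = p ∧ s.reg 2 = k ^ (p + 1) ∧ s.reg 3 = k ^ (2 * p + 2) ∧
    s.reg 4 = 2 * k ^ (2 * p + 2) ∧ s.reg 5 = 3 * k ^ (2 * p + 2) ∧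
    s.reg 6 = 4 * k ^ (2 * p + 2) ∧ s.reg 7 = k ^ (2 * p + 1) ∧ s.reg 8 = 0 ∧ s.reg 9 = 1 ∧
    s.reg 11 = 3

theorem Ready.congr {k p : ℕ} {s s' : Store} (h : Ready k p s)
    (hs : ∀ i < 12, s'.reg i = s.reg i) : Ready k p s' := by
  simp only [Ready] at h ⊢
  rwa [hs 0, hs 1, hs 2, hs 3, hs 4, hs 5, hs 6, hs 7, hs 8, hs 9, hs 11] <;> norm_num

/-- The factor of the phase contributed by both branches of the ditstrings number `n` and `n'`. -/
def pairPhase (inp : Input) (k p n n' : ℕ) : ℂ :=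
  phaseEntry inp k p (n / k ^ (p + 1)) (n' / k ^ (p + 1)) *
    star (phaseEntry inp k p (n % k ^ (p + 1)) (n' % k ^ (p + 1)))

/-- The weight of the ditstring number `n`. -/
def weightAt (inp : Input) (k p n : ℕ) : ℂ :=
  weightEntry inp k p (n / k ^ (p + 1)) (n % k ^ (p + 1))

/-- The branch tensors in terms of the input. -/
def tensorAt (inp : Input) (k p : ℕ) : ℕ → ℕ → ℂ
  | 0 => fun _ => 1
  | r + 1 => fun n => (∑ n' ∈ Finset.range (k ^ (2 * p + 2)),
      pairPhase inp k p n n' * weightAt inp k p n' * tensorAt inp k p r n') ^ inp.param 2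

/-- One summand of the edge value, in terms of the input. -/
def edgeTermAt (inp : Input) (k p n n' : ℕ) : ℂ :=
  pairPhase inp k p n n' * weightAt inp k p n' * tensorAt inp k p p n' *
    inp.data 1 (n / k ^ (2 * p + 1) * k + n' / k ^ (2 * p + 1)) * weightAt inp k p n *
      tensorAt inp k p p n

/-- The tables of phases and weights are in place, and so is a table of values of `h`. -/
def Loaded (inp : Input) (k p : ℕ) (h : ℕ → ℂ) (s : Store) : Prop :=
  (∀ t < k ^ (2 * p + 2), s.mem (k ^ (2 * p + 2) + t) =
      phaseEntry inp k p (t / k ^ (p + 1)) (t % k ^ (p + 1))) ∧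
    (∀ t < k ^ (2 * p + 2), s.mem (2 * k ^ (2 * p + 2) + t) = weightAt inp k p t) ∧
    ∀ t < k ^ (2 * p + 2), s.mem (3 * k ^ (2 * p + 2) + t) = h t

/-- The machine is large enough for the evaluation. -/
structure Fits (S k p : ℕ) : Prop where
  two_le : 2 ≤ k
  one_le : 1 ≤ p
  size : 8 * k ^ (2 * p + 2) ≤ S

/-- All input indices, and `p` itself, fit into registers because `p ≤ 2^p ≤ k^(2p)`. This is where
`k ≥ 2` is needed. -/
theorem Fits.bounds {S k p : ℕ} (h : Fits S k p) :
    4 ≤ k ^ (2 * p + 2) ∧ k ≤ k ^ (2 * p + 2) ∧ p * (k * k) ≤ k ^ (2 * p + 2) ∧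
      k * k ≤ k ^ (2 * p + 2) := by
  have h2 := h.two_le
  have h0 : 4 ≤ k * k := Nat.mul_le_mul h2 h2
  have h3 : k ≤ k * k := Nat.le_mul_of_pos_right _ (by omega)
  have h1 : k * k ≤ k ^ (2 * p + 2) := by
    rw [← sq]
    exact Nat.pow_le_pow_right (by omega) (by omega)
  refine ⟨h0.trans h1, h3.trans h1, ?_, h1⟩
  rw [pow_add, sq]
  refine Nat.mul_le_mul_right _ ?_
  calc p ≤ 2 ^ p := Nat.lt_two_pow_self.le
    _ ≤ 2 ^ (2 * p) := Nat.pow_le_pow_right (by omega) (by omega)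
    _ ≤ k ^ (2 * p) := Nat.pow_le_pow_left h2 _

theorem mul_add_lt_mul {a b c e : ℕ} (ha : a < c) (hb : b < e) : a * e + b < c * e :=
  calc a * e + b < a * e + e := Nat.add_lt_add_left hb _
    _ = (a + 1) * e := (Nat.succ_mul a e).symm
    _ ≤ c * e := Nat.mul_le_mul_right _ ha

/-- The address of a mixer entry is computed by Horner's scheme in a single register, so the
intermediate values must be bounded too. -/
theorem index_lt {k p t a b : ℕ} (ht : t < p) (ha : a < k) (hb : b < k) :
    t * k < p * (k * k) ∧ t * k + a < p * (k * k) ∧ (t * k + a) * k < p * (k * k) ∧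
      (t * k + a) * k + b < p * (k * k) := by
  have h1 : t * k + a < p * k := mul_add_lt_mul ht ha
  have h2 : (t * k + a) * k + b < p * k * k := mul_add_lt_mul h1 hb
  have h3 : (t * k + a) ≤ (t * k + a) * k := Nat.le_mul_of_pos_right _ (by omega)
  rw [mul_assoc] at h2
  omega

theorem Agree.update_reg {r m i c : ℕ} {s : Store} {f : ℕ → ℕ} {g : ℕ → ℂ} (hi : r ≤ i)
    (h : Agree r m s ⟨f, g⟩) : Agree r m s ⟨Function.update f i c, g⟩ :=
  ⟨fun j hj => (Function.update_of_ne (by omega) _ _).trans (h.1 j hj), h.2⟩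

theorem Agree.update_mem {r m i : ℕ} {c : ℂ} {s : Store} {f : ℕ → ℕ} {g : ℕ → ℂ} (hi : i < m)
    (h : Agree r m s ⟨f, g⟩) : Agree r m s ⟨f, Function.update g i c⟩ :=
  ⟨h.1, fun j hj => (Function.update_of_ne (by omega) _ _).trans (h.2 j hj)⟩

/-- Evaluates one weight into cell `3`. -/
def weightBody : Prog :=
  .seq (.block (.index .div 15 13 2) [.index .mod 16 13 2, .index .mod 17 15 0, .read 11 4 17,
      .cellFun .conj 11 11, .index .mod 17 16 0, .read 8 4 17, .cellOp .mul 11 11 8])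
    (.seq
      (.accumulate .mul 1 (.block (.index .mod 17 15 0) [.index .div 15 15 0,
        .index .mod 18 15 0, .index .mul 19 14 0, .index .add 19 19 18, .index .mul 19 19 0,
        .index .add 19 19 17, .read 8 3 19, .cellFun .conj 8 8, .index .mod 17 16 0,
        .index .div 16 16 0, .index .mod 18 16 0, .index .mul 19 14 0, .index .add 19 19 18,
        .index .mul 19 19 0, .index .add 19 19 17, .read 9 3 19, .cellOp .mul 8 8 9]))
      (.ifEq 15 16 (.instr (.const 17 0)) (.instr (.cellConst .zero 11))))

/-- Evaluates one phase factor into cell `3`. -/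
def phaseBody : Prog :=
  .seq (.block (.index .div 15 13 2) [.index .mod 16 13 2, .cellConst .zero 11])
    (.seq
      (.accumulate .add 1 (.block (.index .mod 17 15 0) [.index .div 15 15 0,
        .index .mod 18 16 0, .index .div 16 16 0, .index .mul 17 17 0, .index .add 17 17 18,
        .read 8 0 17, .read 9 2 14, .cellOp .mul 8 8 9]))
      (.block (.cellConst .imag 8) [.cellOp .mul 11 11 8, .cellFun .exp 11 11]))

/-- Evaluates one summand of the sum over branches into cell `0`. -/
def branchTerm : Prog :=
  .block (.index .div 17 13 2) [.index .div 18 14 2, .index .mul 17 17 2, .index .add 17 17 18,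
    .index .add 17 3 17, .cellFun .copy 8 17, .index .mod 17 13 2, .index .mod 18 14 2,
    .index .mul 17 17 2, .index .add 17 17 18, .index .add 17 3 17, .cellFun .conj 9 17,
    .cellOp .mul 8 8 9, .index .add 17 4 14, .cellFun .copy 9 17, .cellOp .mul 8 8 9,
    .index .add 17 5 14, .cellFun .copy 9 17, .cellOp .mul 8 8 9]

/-- Evaluates one summand of the edge value into cell `0`. -/
def edgeTerm : Prog :=
  .seq branchTerm (.block (.index .div 17 13 7) [.index .div 18 14 7, .index .mul 17 17 0,
    .index .add 17 17 18, .read 9 1 17, .cellOp .mul 8 8 9, .index .add 17 4 13,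
    .cellFun .copy 9 17, .cellOp .mul 8 8 9, .index .add 17 5 13, .cellFun .copy 9 17,
    .cellOp .mul 8 8 9])

/-- Evaluates one entry of the next branch tensor into cell `3`. -/
def tensorBody : Prog :=
  .seq (.seq (.instr (.cellConst .zero 11)) (.accumulate .add 3 branchTerm))
    (.instr (.cellFun (.pow 2) 11 11))

/-- Replaces the branch tensor by the next one. -/
def tensorStep : Prog :=
  .seq (.fill 3 6 tensorBody) (.fill 3 5 (.block (.index .add 17 6 13) [.cellFun .copy 11 17]))

/-- Evaluates one row of the edge value into cell `3`. -/
def edgeBody : Prog :=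
  .seq (.instr (.cellConst .zero 11)) (.accumulate .add 3 edgeTerm)

/-- Initializes the index registers. -/
def setup : Prog :=
  .seq (.block (.param 1 1) [.const 2 1, .const 9 1, .const 11 3])
    (.seq (.loop 14 1 (.instr (.index .mul 2 2 0)))
      (.block (.index .mul 7 2 2) [.index .mul 7 7 0, .index .mul 2 2 0, .index .mul 3 2 2,
        .index .add 4 3 3, .index .add 5 4 3, .index .add 6 5 3]))

/-- Sums the rows of the edge value into cell `0`. -/
def collect : Prog :=
  .seq (.seq (.instr (.cellConst .zero 11))
      (.accumulate .add 3 (.block (.index .add 17 6 14) [.cellFun .copy 8 17])))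
    (.instr (.cellFun .copy 8 11))

/-- Evaluates the formula for qudits with at least two levels. -/
def evaluateMain : Prog :=
  .seq setup (.seq (.fill 3 3 phaseBody) (.seq (.fill 3 4 weightBody)
    (.seq (.fill 3 5 (.instr (.cellConst .one 11))) (.seq (.loop 12 1 tensorStep)
      (.seq (.fill 3 6 edgeBody) collect)))))

/-- Evaluates the formula. -/
def evaluate : Prog :=
  .seq (.block (.param 0 0) [.const 17 1]) (.ifEq 0 17 (.instr (.read 8 1 8)) evaluateMain)

variable {S k p : ℕ} {inp : Input}

theorem runs_weightBody (hF : Fits S k p) {s : Store} (hs : Ready k p s) {n : ℕ}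
    (hn : n < k ^ (2 * p + 2)) (h13 : s.reg 13 = n) :
    weightBody.Runs S inp (8 + ((1 + p * 20) + 2)) s fun s' =>
      Agree 14 4 s s' ∧ s'.mem 3 = weightAt inp k p n := by
  obtain ⟨hN, hkN, hpk, -⟩ := hF.bounds
  have hS := hF.size
  have hk := hF.two_le
  have hp := hF.one_le
  obtain ⟨r, m⟩ := s
  have hx : n / k ^ (p + 1) ≤ n := Nat.div_le_self _ _
  have hy : n % k ^ (p + 1) ≤ n := Nat.mod_le _ _
  rw [weightAt]
  have hmod : ∀ a, a % k < k := fun a => Nat.mod_lt _ (by omega)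
  have hxk := hmod (n / k ^ (p + 1))
  have hyk := hmod (n % k ^ (p + 1))
  refine (runs_block (Q := fun s' => Agree 14 4 ⟨r, m⟩ s' ∧ s'.reg 15 = n / k ^ (p + 1) ∧
    s'.reg 16 = n % k ^ (p + 1) ∧ s'.mem 3 = star (inp.data 4 (n / k ^ (p + 1) % k)) *
      inp.data 4 (n % k ^ (p + 1) % k)) ?_).seq fun s' hs' => ?_
  · obtain ⟨h0, h1, h2, h3, h4, h5, h6, h7, h8, h9, h11⟩ := hs
    simp only at h0 h1 h2 h3 h4 h5 h6 h7 h8 h9 h11 h13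
    simp only [establishes_index, establishes_read, establishes_cellFun, establishes_cellOp,
      establishes_nil, Function.update_apply, IndexOp.eval, CellOp.eval, CellFun.eval,
      Nat.reduceEqDiff, reduceIte, h0, h2, h8, h11, h13]
    -- Here and below the count is the number of bounds: one per index operation or input read, two
    -- per `cellFun`, three per `cellOp`.
    iterate 11 refine ⟨by omega, ?_⟩
    refine ⟨?_, trivial, trivial, trivial⟩
    repeat first
      | exact Agree.refl _ _ _
      | refine Agree.update_reg (by norm_num) ?_
      | refine Agree.update_mem (by norm_num) ?_
  generalize n / k ^ (p + 1) = x at *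
  generalize n % k ^ (p + 1) = y at *
  obtain ⟨hA, h15, h16, hm3⟩ := hs'
  have hs' := hs.congr fun i hi => hA.1 i (by omega)
  refine (runs_accumulate (n := p) (T := 18) (by omega) hs'.2.1 hs'.2.2.2.2.2.2.2.2.1
    hs'.2.2.2.2.2.2.2.2.2.2
    (fun t => star (inp.data 3 ((t * k + digit k x (t + 1)) * k + digit k x t)) *
        inp.data 3 ((t * k + digit k y (t + 1)) * k + digit k y t))
    (fun t => (star (inp.data 4 (x % k)) * inp.data 4 (y % k)) * ∏ t ∈ Finset.range t,
      (star (inp.data 3 ((t * k + digit k x (t + 1)) * k + digit k x t)) *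
        inp.data 3 ((t * k + digit k y (t + 1)) * k + digit k y t)))
    (by simp [hm3]) (fun t _ => by
      rw [Finset.prod_range_succ]
      exact (mul_assoc _ _ _).symm)
    -- Each round divides both path numbers by `k`, so digits `t` and `t + 1` are always the two
    -- lowest. After `p` rounds only the last digits remain, ready for the test `a_{p+1} =
    -- a_{-p-1}`.
    (fun t a b => a = x / k ^ t ∧ b = y / k ^ t) (by simp [h15, h16])
    fun t ht s'' hA' h14 hR => ?_).seq fun s'' hs'' => ?_
  · have hs'' := hs'.congr fun i hi => hA'.1 i (by omega)
    obtain ⟨r'', m''⟩ := s''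
    obtain ⟨h0, h1, h2, h3, h4, h5, h6, h7, h8, h9, h11⟩ := hs''
    simp only at h0 h1 h2 h3 h4 h5 h6 h7 h8 h9 h11 h14 hR
    refine runs_block ?_
    have hx' : x / k ^ t ≤ x := Nat.div_le_self _ _
    have hy' : y / k ^ t ≤ y := Nat.div_le_self _ _
    have hx'' : x / k ^ (t + 1) ≤ x := Nat.div_le_self _ _
    have hy'' : y / k ^ (t + 1) ≤ y := Nat.div_le_self _ _
    have hax := hmod (x / k ^ t)
    have hay := hmod (y / k ^ t)
    have hbx := hmod (x / k ^ (t + 1))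
    have hby := hmod (y / k ^ (t + 1))
    obtain ⟨i1, i2, i3, i4⟩ := index_lt ht hbx hax
    obtain ⟨j1, j2, j3, j4⟩ := index_lt ht hby hay
    simp only [establishes_index, establishes_read, establishes_cellFun, establishes_cellOp,
      establishes_nil, Function.update_apply, IndexOp.eval, CellOp.eval, CellFun.eval,
      Nat.reduceEqDiff, reduceIte, h0, h8, h9, h14, hR.1, hR.2, Nat.div_div_eq_div_mul,
      ← pow_succ, one_ne_zero, zero_ne_one]
    iterate 21 refine ⟨by omega, ?_⟩
    refine ⟨?_, rfl, trivial, trivial⟩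
    repeat first
      | exact Agree.refl _ _ _
      | refine Agree.update_reg (by norm_num) ?_
      | refine Agree.update_mem (by norm_num) ?_
  · obtain ⟨hA', hR, hm3'⟩ := hs''
    have hs'' := hs'.congr fun i hi => hA'.1 i (by omega)
    have hAA := hA.trans hA' (r'' := 14) (m'' := 4) le_rfl le_rfl le_rfl le_rfl
    obtain ⟨r'', m''⟩ := s''
    refine (Prog.Runs.ifEq (T := 1) (fun h => ?_) fun h => ?_).mono le_rfl fun _ h => h
    -- Equal ends: the accumulated product stands, and the instruction executed is a dummy on a
    -- scratch register.
    · refine runs_block (cs := []) ?_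
      simp only at h hR hm3'
      rw [establishes_const, establishes_nil]
      refine ⟨by omega, hAA.update_reg (by norm_num), ?_⟩
      rw [weightEntry, if_pos (by rw [← hR.1, ← hR.2, h])]
      exact hm3'
    · refine runs_block (cs := []) ?_
      have h11 : r'' 11 = 3 := hs''.2.2.2.2.2.2.2.2.2.2
      simp only at h hR
      rw [establishes_cellConst, establishes_nil, h11]
      refine ⟨by omega, hAA.update_mem (by norm_num), ?_⟩
      rw [weightEntry, if_neg (by rw [← hR.1, ← hR.2]; exact h)]
      simp [CellConst.eval]

end Program

/-! ### Phase factors, summands, and entries of the branch tensors. -/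

section ProgramCorrectness

open Prog

variable {S k p : ℕ} {inp : Input}

theorem runs_phaseBody (hF : Fits S k p) {s : Store} (hs : Ready k p s) {n : ℕ}
    (hn : n < k ^ (2 * p + 2)) (h13 : s.reg 13 = n) :
    phaseBody.Runs S inp (3 + ((1 + p * 11) + 3)) s fun s' =>
      Agree 14 4 s s' ∧
        s'.mem 3 = phaseEntry inp k p (n / k ^ (p + 1)) (n % k ^ (p + 1)) := by
  obtain ⟨hN, hkN, hpk, hkk⟩ := hF.bounds
  have hS := hF.size
  have hk := hF.two_le
  have hp := hF.one_le
  obtain ⟨r, m⟩ := s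
  have hx : n / k ^ (p + 1) ≤ n := Nat.div_le_self _ _
  have hy : n % k ^ (p + 1) ≤ n := Nat.mod_le _ _
  have hmod : ∀ a, a % k < k := fun a => Nat.mod_lt _ (by omega)
  refine (runs_block (Q := fun s' => Agree 14 4 ⟨r, m⟩ s' ∧ s'.reg 15 = n / k ^ (p + 1) ∧
    s'.reg 16 = n % k ^ (p + 1) ∧ s'.mem 3 = 0) ?_).seq fun s' hs' => ?_
  · obtain ⟨h0, h1, h2, h3, h4, h5, h6, h7, h8, h9, h11⟩ := hs
    simp only at h0 h1 h2 h3 h4 h5 h6 h7 h8 h9 h11 h13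
    simp only [establishes_index, establishes_cellConst, establishes_nil, Function.update_apply,
      IndexOp.eval, CellConst.eval, Nat.reduceEqDiff, reduceIte, h2, h11, h13]
    iterate 3 refine ⟨by omega, ?_⟩
    refine ⟨?_, trivial, trivial, trivial⟩
    repeat first
      | exact Agree.refl _ _ _
      | refine Agree.update_reg (by norm_num) ?_
      | refine Agree.update_mem (by norm_num) ?_
  generalize n / k ^ (p + 1) = x at *
  generalize n % k ^ (p + 1) = y at *
  obtain ⟨hA, h15, h16, hm3⟩ := hs'
  have hs' := hs.congr fun i hi => hA.1 i (by omega)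
  refine (runs_accumulate (n := p) (T := 9) (by omega) hs'.2.1 hs'.2.2.2.2.2.2.2.2.1
    hs'.2.2.2.2.2.2.2.2.2.2
    (fun t => inp.data 0 (digit k x t * k + digit k y t) * inp.data 2 t)
    (fun t => ∑ t ∈ Finset.range t,
      inp.data 0 (digit k x t * k + digit k y t) * inp.data 2 t)
    (by simp [hm3]) (fun t _ => Finset.sum_range_succ _ _)
    (fun t a b => a = x / k ^ t ∧ b = y / k ^ t) (by simp [h15, h16])
    fun t ht s'' hA' h14 hR => ?_).seq fun s'' hs'' => ?_
  · have hs'' := hs'.congr fun i hi => hA'.1 i (by omega)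
    obtain ⟨r'', m''⟩ := s''
    obtain ⟨h0, h1, h2, h3, h4, h5, h6, h7, h8, h9, h11⟩ := hs''
    simp only at h0 h1 h2 h3 h4 h5 h6 h7 h8 h9 h11 h14 hR
    refine runs_block ?_
    have hx' : x / k ^ t ≤ x := Nat.div_le_self _ _
    have hy' : y / k ^ t ≤ y := Nat.div_le_self _ _
    have hx'' : x / k ^ (t + 1) ≤ x := Nat.div_le_self _ _
    have hy'' : y / k ^ (t + 1) ≤ y := Nat.div_le_self _ _
    have hax := hmod (x / k ^ t)
    have hay := hmod (y / k ^ t)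
    have hidx : x / k ^ t % k * k + y / k ^ t % k < k * k := mul_add_lt_mul hax hay
    simp only [establishes_index, establishes_read, establishes_cellOp,
      establishes_nil, Function.update_apply, IndexOp.eval, CellOp.eval,
      Nat.reduceEqDiff, reduceIte, h0, h8, h9, h14, hR.1, hR.2, Nat.div_div_eq_div_mul,
      ← pow_succ, one_ne_zero, zero_ne_one]
    iterate 11 refine ⟨by omega, ?_⟩
    refine ⟨?_, rfl, trivial, trivial⟩
    repeat first
      | exact Agree.refl _ _ _
      | refine Agree.update_reg (by norm_num) ?_
      | refine Agree.update_mem (by norm_num) ?_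
  · obtain ⟨hA', hR, hm3'⟩ := hs''
    have hs'' := hs'.congr fun i hi => hA'.1 i (by omega)
    have hAA := hA.trans hA' (r'' := 14) (m'' := 4) le_rfl le_rfl le_rfl le_rfl
    obtain ⟨r'', m''⟩ := s''
    have h8 : r'' 8 = 0 := hs''.2.2.2.2.2.2.2.2.1
    have h11 : r'' 11 = 3 := hs''.2.2.2.2.2.2.2.2.2.2
    simp only at hm3'
    refine runs_block ?_
    simp only [establishes_cellConst, establishes_cellFun, establishes_cellOp,
      establishes_nil, Function.update_apply, CellOp.eval, CellFun.eval, CellConst.eval, h8, h11,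
      OfNat.ofNat_ne_zero, reduceIte, hm3']
    iterate 6 refine ⟨by omega, ?_⟩
    exact ⟨((hAA.update_mem (by norm_num)).update_mem (by norm_num)).update_mem (by norm_num), rfl⟩

theorem div_mul_add_lt {k p n n' : ℕ} (hk : 2 ≤ k) (hn : n < k ^ (2 * p + 2))
    (hn' : n' < k ^ (2 * p + 2)) :
    n / k ^ (p + 1) * k ^ (p + 1) + n' / k ^ (p + 1) < k ^ (2 * p + 2) ∧
      n % k ^ (p + 1) * k ^ (p + 1) + n' % k ^ (p + 1) < k ^ (2 * p + 2) := by
  have hM : 0 < k ^ (p + 1) := Nat.pow_pos (by omega)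
  have hMM : k ^ (2 * p + 2) = k ^ (p + 1) * k ^ (p + 1) := by rw [← pow_add]; congr 1; omega
  rw [hMM] at hn hn' ⊢
  have h1 := Nat.div_lt_of_lt_mul hn
  have h2 := Nat.div_lt_of_lt_mul hn'
  have h3 := Nat.mod_lt n hM
  have h4 := Nat.mod_lt n' hM
  exact ⟨mul_add_lt_mul h1 h2, mul_add_lt_mul h3 h4⟩

theorem mul_add_div_mod {k p x y : ℕ} (hy : y < k ^ (p + 1)) :
    (x * k ^ (p + 1) + y) / k ^ (p + 1) = x ∧ (x * k ^ (p + 1) + y) % k ^ (p + 1) = y := by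
  have hM : 0 < k ^ (p + 1) := by omega
  constructor
  · rw [mul_comm, Nat.mul_add_div hM, Nat.div_eq_of_lt hy, add_zero]
  · rw [mul_comm, Nat.mul_add_mod, Nat.mod_eq_of_lt hy]

/-- The number of steps does not depend on `p`: the phase is the product of one table entry for the
bra paths and a conjugated one for the ket paths. -/
theorem runs_branchTerm (hF : Fits S k p) {s : Store} (hs : Ready k p s) {h : ℕ → ℂ}
    (hL : Loaded inp k p h s) {n n' : ℕ} (hn : n < k ^ (2 * p + 2)) (hn' : n' < k ^ (2 * p + 2))
    (h13 : s.reg 13 = n) (h14 : s.reg 14 = n') :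
    branchTerm.Runs S inp 19 s fun s' => Agree 15 3 s s' ∧
      s'.mem 0 = pairPhase inp k p n n' * weightAt inp k p n' * h n' := by
  obtain ⟨hN, hkN, hpk, hkk⟩ := hF.bounds
  have hS := hF.size
  have hk := hF.two_le
  obtain ⟨r, m⟩ := s
  obtain ⟨h0, h1, h2, h3, h4, h5, h6, h7, h8, h9, h11⟩ := hs
  simp only at h0 h1 h2 h3 h4 h5 h6 h7 h8 h9 h11 h13 h14
  obtain ⟨hL1, hL2, hL3⟩ := hL
  simp only at hL1 hL2 hL3
  obtain ⟨i1, i2⟩ := div_mul_add_lt hk hn hn'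
  have hM : 0 < k ^ (p + 1) := Nat.pow_pos (by omega)
  have hx : n / k ^ (p + 1) ≤ n := Nat.div_le_self _ _
  have hy : n % k ^ (p + 1) ≤ n := Nat.mod_le _ _
  have hx' : n' / k ^ (p + 1) ≤ n' := Nat.div_le_self _ _
  have hy' : n' % k ^ (p + 1) ≤ n' := Nat.mod_le _ _
  have hx'M : n' / k ^ (p + 1) < k ^ (p + 1) :=
    Nat.div_lt_of_lt_mul (by rw [← pow_add]; convert hn' using 2; omega)
  have i1' := (Nat.le_add_right _ _).trans_lt i1
  have i2' := (Nat.le_add_right _ _).trans_lt i2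
  have e1 := hL1 _ i1
  have e2 := hL1 _ i2
  have e3 := hL2 _ hn'
  have e4 := hL3 _ hn'
  rw [(mul_add_div_mod hx'M).1, (mul_add_div_mod hx'M).2] at e1
  rw [(mul_add_div_mod (Nat.mod_lt _ hM)).1, (mul_add_div_mod (Nat.mod_lt _ hM)).2] at e2
  -- The tables are disjoint from the scratch cells, so reading them is not disturbed by
  -- intermediate results.
  have z0 : ∀ a, k ^ (2 * p + 2) + a ≠ 0 := fun a => by omega
  have z2 : ∀ a, 2 * k ^ (2 * p + 2) + a ≠ 0 := fun a => by omega
  have z3 : ∀ a, 2 * k ^ (2 * p + 2) + a ≠ 1 := fun a => by omega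
  have z4 : ∀ a, 3 * k ^ (2 * p + 2) + a ≠ 0 := fun a => by omega
  have z5 : ∀ a, 3 * k ^ (2 * p + 2) + a ≠ 1 := fun a => by omega
  refine runs_block ?_
  simp only [establishes_index, establishes_cellFun, establishes_cellOp,
    establishes_nil, Function.update_apply, IndexOp.eval, CellOp.eval, CellFun.eval,
    Nat.reduceEqDiff, reduceIte, h2, h3, h4, h5, h8, h9, h13, h14, one_ne_zero, zero_ne_one,
    z0, z2, z3, z4, z5, e1, e2, e3, e4]
  iterate 29 refine ⟨by omega, ?_⟩
  refine ⟨?_, by rw [pairPhase]⟩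
  repeat first
    | exact Agree.refl _ _ _
    | refine Agree.update_reg (by norm_num) ?_
    | refine Agree.update_mem (by norm_num) ?_

theorem Loaded.of_agree {h : ℕ → ℂ} {s s' : Store} (hF : Fits S k p) (hL : Loaded inp k p h s)
    (hs : ∀ a, 4 ≤ a → s'.mem a = s.mem a) : Loaded inp k p h s' := by
  have hN := hF.bounds.1
  exact ⟨fun t ht => (hs _ (by omega)).trans (hL.1 t ht),
    fun t ht => (hs _ (by omega)).trans (hL.2.1 t ht),
    fun t ht => (hs _ (by omega)).trans (hL.2.2 t ht)⟩

/-- Division by `k^(2p+1)` extracts the top digit of a ditstring number, the entry `a_{p+1}` on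
which `ξ` depends. -/
theorem runs_edgeTerm (hF : Fits S k p) {s : Store} (hs : Ready k p s)
    (hL : Loaded inp k p (tensorAt inp k p p) s) {n n' : ℕ} (hn : n < k ^ (2 * p + 2))
    (hn' : n' < k ^ (2 * p + 2)) (h13 : s.reg 13 = n) (h14 : s.reg 14 = n') :
    edgeTerm.Runs S inp (19 + 12) s fun s' => Agree 15 3 s s' ∧
      s'.mem 0 = edgeTermAt inp k p n n' := by
  obtain ⟨hN, hkN, hpk, hkk⟩ := hF.bounds
  have hS := hF.size
  have hk := hF.two_le
  have hp := hF.one_le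
  refine (runs_branchTerm hF hs hL hn hn' h13 h14).seq fun s' hs' => ?_
  obtain ⟨hA, hm0⟩ := hs'
  have hL' : Loaded inp k p (tensorAt inp k p p) s' :=
    hL.of_agree hF fun a ha => hA.2 a (by omega)
  have hs' := hs.congr fun i hi => hA.1 i (by omega)
  have h13' : s'.reg 13 = n := (hA.1 13 (by norm_num)).trans h13
  have h14' : s'.reg 14 = n' := (hA.1 14 (by norm_num)).trans h14
  obtain ⟨r, m⟩ := s'
  obtain ⟨h0, h1, h2, h3, h4, h5, h6, h7, h8, h9, h11⟩ := hs'
  simp only at h0 h1 h2 h3 h4 h5 h6 h7 h8 h9 h11 h13' h14' hm0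
  obtain ⟨-, hL2, hL3⟩ := hL'
  have e3 := hL2 _ hn
  have e4 := hL3 _ hn
  simp only at e3 e4
  have z2 : ∀ a, 2 * k ^ (2 * p + 2) + a ≠ 0 := fun a => by omega
  have z3 : ∀ a, 2 * k ^ (2 * p + 2) + a ≠ 1 := fun a => by omega
  have z4 : ∀ a, 3 * k ^ (2 * p + 2) + a ≠ 0 := fun a => by omega
  have z5 : ∀ a, 3 * k ^ (2 * p + 2) + a ≠ 1 := fun a => by omega
  have hpow : k ^ (2 * p + 2) = k ^ (2 * p + 1) * k := pow_succ _ _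
  have hx : n / k ^ (2 * p + 1) < k := Nat.div_lt_of_lt_mul (hpow ▸ hn)
  have hx' : n' / k ^ (2 * p + 1) < k := Nat.div_lt_of_lt_mul (hpow ▸ hn')
  have hidx : n / k ^ (2 * p + 1) * k + n' / k ^ (2 * p + 1) < k * k := mul_add_lt_mul hx hx'
  have hidx' := (Nat.le_add_right _ _).trans_lt hidx
  refine runs_block ?_
  simp only [establishes_index, establishes_cellFun, establishes_cellOp, establishes_read,
    establishes_nil, Function.update_apply, IndexOp.eval, CellOp.eval, CellFun.eval,
    Nat.reduceEqDiff, reduceIte, h0, h4, h5, h7, h8, h9, h13', h14', one_ne_zero, zero_ne_one,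
    z2, z3, z4, z5, e3, e4, hm0]
  iterate 20 refine ⟨by omega, ?_⟩
  refine ⟨?_, by rw [edgeTermAt]⟩
  repeat first
    | exact hA
    | refine Agree.update_reg (by norm_num) ?_
    | refine Agree.update_mem (by norm_num) ?_

theorem runs_zero {s : Store} (hS : 3 < S) (hs : Ready k p s) :
    (Prog.instr (.cellConst .zero 11)).Runs S inp 1 s fun s' => Agree 14 4 s s' ∧
      s'.mem 3 = 0 := by
  obtain ⟨r, m⟩ := s
  have h11 : r 11 = 3 := hs.2.2.2.2.2.2.2.2.2.2
  refine runs_block (cs := []) ?_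
  rw [establishes_cellConst, establishes_nil, h11]
  exact ⟨hS, (Agree.refl _ _ _).update_mem (by norm_num), by simp [CellConst.eval]⟩

theorem runs_sum {s : Store} (hF : Fits S k p) (hs : Ready k p s) {body : Prog} {T : ℕ}
    (v : ℕ → ℂ) (hbody : ∀ t < k ^ (2 * p + 2), ∀ s', Agree 14 4 s s' → s'.reg 14 = t →
      body.Runs S inp T s' fun s'' => Agree 15 3 s' s'' ∧ s''.mem 0 = v t) :
    (Prog.seq (.instr (.cellConst .zero 11)) (.accumulate .add 3 body)).Runs S inp
      (1 + (1 + k ^ (2 * p + 2) * (2 + T))) s fun s' => Agree 14 4 s s' ∧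
        s'.mem 3 = ∑ t ∈ Finset.range (k ^ (2 * p + 2)), v t := by
  have hN := hF.bounds.1
  have hS := hF.size
  refine (runs_zero (by omega) hs).seq fun s' hs' => ?_
  obtain ⟨hA, hm3⟩ := hs'
  have hs' := hs.congr fun i hi => hA.1 i (by omega)
  refine (runs_accumulate (by omega) hs'.2.2.2.1 hs'.2.2.2.2.2.2.2.2.1
    hs'.2.2.2.2.2.2.2.2.2.2 v (fun t => ∑ t ∈ Finset.range t, v t)
    (by simp [hm3]) (fun t _ => Finset.sum_range_succ _ _)
    (fun _ _ _ => True) trivial fun t ht s'' hA' h14 _ => ?_).mono le_rfl fun s'' h =>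
      ⟨hA.trans h.1 le_rfl le_rfl le_rfl le_rfl, h.2.2⟩
  refine (hbody t ht s'' (hA.trans hA' le_rfl le_rfl le_rfl le_rfl) h14).mono le_rfl
    fun s₃ h => ⟨h.1, h.2, trivial⟩

theorem runs_tensorBody (hF : Fits S k p) {s : Store} (hs : Ready k p s) {i : ℕ}
    (hL : Loaded inp k p (tensorAt inp k p i) s) {n : ℕ} (hn : n < k ^ (2 * p + 2))
    (h13 : s.reg 13 = n) :
    tensorBody.Runs S inp (1 + (1 + k ^ (2 * p + 2) * (2 + 19)) + 1) s fun s' => Agree 14 4 s s' ∧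
      s'.mem 3 = tensorAt inp k p (i + 1) n := by
  have hN := hF.bounds.1
  have hS := hF.size
  refine (runs_sum hF hs (fun n' => pairPhase inp k p n n' * weightAt inp k p n' *
    tensorAt inp k p i n') fun t ht s' hA h14 => ?_).seq fun s' hs' => ?_
  · exact runs_branchTerm hF (hs.congr fun i hi => hA.1 i (by omega)) (hL.of_agree hF hA.2) hn ht
      ((hA.1 13 (by norm_num)).trans h13) h14
  · obtain ⟨hA, hm3⟩ := hs'
    have h11 := (hs.congr fun i hi => hA.1 i (by omega)).2.2.2.2.2.2.2.2.2.2
    obtain ⟨r, m⟩ := s'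
    simp only at h11 hm3
    refine runs_block (cs := []) ?_
    rw [establishes_cellFun, establishes_nil, h11, hm3]
    exact ⟨by omega, by omega, hA.update_mem (by norm_num), by simp [CellFun.eval, tensorAt]⟩

theorem runs_edgeBody (hF : Fits S k p) {s : Store} (hs : Ready k p s)
    (hL : Loaded inp k p (tensorAt inp k p p) s) {n : ℕ} (hn : n < k ^ (2 * p + 2))
    (h13 : s.reg 13 = n) :
    edgeBody.Runs S inp (1 + (1 + k ^ (2 * p + 2) * (2 + (19 + 12)))) s fun s' => Agree 14 4 s s' ∧
      s'.mem 3 = ∑ n' ∈ Finset.range (k ^ (2 * p + 2)), edgeTermAt inp k p n n' :=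
  runs_sum hF hs (fun n' => edgeTermAt inp k p n n') fun t ht s' hA h14 =>
    runs_edgeTerm hF (hs.congr fun i hi => hA.1 i (by omega)) (hL.of_agree hF hA.2) hn ht
      ((hA.1 13 (by norm_num)).trans h13) h14

end ProgramCorrectness

/-! ### Initialization, iteration of the tensors, and the total cost. -/

section ProgramTotal

open Prog

variable {S k p : ℕ} {inp : Input}

theorem Ready.of_agreeOff {b n : ℕ} {s s' : Store} (h : Ready k p s) (hs : AgreeOff b n s s') :
    Ready k p s' := h.congr fun i hi => hs.1 i (by omega)

theorem runs_setup (hF : Fits S k p) (hp : inp.param 1 = p) {s : Store}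
    (h0 : s.reg 0 = k) (h8 : s.reg 8 = 0) :
    setup.Runs S inp (4 + ((1 + p * 2) + 7)) s (Ready k p) := by
  obtain ⟨hN, hkN, hpk, hkk⟩ := hF.bounds
  have hS := hF.size
  have hk := hF.two_le
  have hpN : p ≤ p * (k * k) := Nat.le_mul_of_pos_right _ (Nat.mul_pos (by omega) (by omega))
  refine (runs_block (Q := fun s' => s'.reg 0 = k ∧ s'.reg 1 = p ∧ s'.reg 2 = 1 ∧ s'.reg 8 = 0 ∧
    s'.reg 9 = 1 ∧ s'.reg 11 = 3) ?_).seq fun s' hs' => ?_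
  · obtain ⟨r, m⟩ := s
    simp only at h0 h8
    simp only [establishes_const, establishes_param, establishes_nil, Function.update_apply,
      Nat.reduceEqDiff, reduceIte, hp, h0, h8, OfNat.zero_ne_ofNat, OfNat.ofNat_ne_one,
      OfNat.one_ne_ofNat, zero_ne_one, and_true]
    omega
  refine (Prog.Runs.loop (n := p) (T := 1) hs'.2.1 (fun t s' => s'.reg 0 = k ∧ s'.reg 1 = p ∧
    s'.reg 2 = k ^ t ∧ s'.reg 8 = 0 ∧ s'.reg 9 = 1 ∧ s'.reg 11 = 3) hs' ?_).seq
    fun s' hs' => ?_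
  · rintro t ht ⟨r, m⟩ ⟨h0, h1, h2, h8, h9, h11⟩
    simp only at h0 h1 h2 h8 h9 h11
    refine runs_block (cs := []) ?_
    have hpow : k ^ t * k ≤ k ^ (2 * p + 2) := by
      rw [← pow_succ]
      exact Nat.pow_le_pow_right (by omega) (by omega)
    simp only [establishes_index, establishes_nil, Function.update_apply, IndexOp.eval,
      Nat.reduceEqDiff, reduceIte, h0, h1, h2, h8, h9, h11, OfNat.zero_ne_ofNat,
      OfNat.one_ne_ofNat, and_true, pow_succ]
    omega
  · obtain ⟨r, m⟩ := s'
    obtain ⟨h0, h1, h2, h8, h9, h11⟩ := hs'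
    simp only at h0 h1 h2 h8 h9 h11
    refine runs_block ?_
    -- The loop has left `k^p` in register `2`; all table sizes and offsets derive from it by a
    -- bounded number of operations.
    have e1 : k ^ p * k ^ p * k = k ^ (2 * p + 1) := by ring
    have e2 : k ^ p * k = k ^ (p + 1) := (pow_succ _ _).symm
    have e3 : k ^ (p + 1) * k ^ (p + 1) = k ^ (2 * p + 2) := by ring
    have e4 : k ^ p * k ^ p ≤ k ^ (2 * p + 2) := by
      rw [← pow_add]
      exact Nat.pow_le_pow_right (by omega) (by omega)
    have e5 : k ^ (2 * p + 1) ≤ k ^ (2 * p + 2) := Nat.pow_le_pow_right (by omega) (by omega)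
    have e6 : k ^ (p + 1) ≤ k ^ (2 * p + 2) := Nat.pow_le_pow_right (by omega) (by omega)
    simp only [Ready, establishes_index, establishes_nil, Function.update_apply, IndexOp.eval,
      Nat.reduceEqDiff, reduceIte, h0, h1, h2, h8, h9, h11, OfNat.zero_ne_ofNat,
      OfNat.one_ne_ofNat, and_true, true_and, e1, e2, e3]
    omega

theorem runs_one {s : Store} (hS : 3 < S) (hs : Ready k p s) :
    (Prog.instr (.cellConst .one 11)).Runs S inp 1 s fun s' => Agree 14 4 s s' ∧
      s'.mem 3 = 1 := by
  obtain ⟨r, m⟩ := s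
  have h11 : r 11 = 3 := hs.2.2.2.2.2.2.2.2.2.2
  refine runs_block (cs := []) ?_
  rw [establishes_cellConst, establishes_nil, h11]
  exact ⟨hS, (Agree.refl _ _ _).update_mem (by norm_num), by simp [CellConst.eval]⟩

theorem Loaded.of_agreeOff {b : ℕ} {h : ℕ → ℂ} {s s' : Store} (hF : Fits S k p)
    (hL : Loaded inp k p h s) (hb : 4 * k ^ (2 * p + 2) ≤ b)
    (hs : AgreeOff b (k ^ (2 * p + 2)) s s') : Loaded inp k p h s' := by
  have hN := hF.bounds.1
  exact ⟨fun t ht => (hs.2 _ (by omega) (by omega)).trans (hL.1 t ht),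
    fun t ht => (hs.2 _ (by omega) (by omega)).trans (hL.2.1 t ht),
    fun t ht => (hs.2 _ (by omega) (by omega)).trans (hL.2.2 t ht)⟩

/-- Every new entry depends on all old ones, so the new tensor is built in the array at `4 k^(2p+2)`
and copied back afterwards. -/
theorem runs_tensorStep (hF : Fits S k p) {s : Store} (hs : Ready k p s) {i : ℕ}
    (hL : Loaded inp k p (tensorAt inp k p i) s) :
    tensorStep.Runs S inp
      ((1 + k ^ (2 * p + 2) * (3 + (1 + (1 + k ^ (2 * p + 2) * (2 + 19)) + 1))) +
        (1 + k ^ (2 * p + 2) * (3 + 2))) s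
      fun s' => Ready k p s' ∧ Loaded inp k p (tensorAt inp k p (i + 1)) s' := by
  have hN := hF.bounds.1
  have hS := hF.size
  refine (runs_fill (base := 4 * k ^ (2 * p + 2)) (n := k ^ (2 * p + 2)) (by omega) (by omega)
    (by norm_num) hs.2.2.2.1 hs.2.2.2.2.2.2.1 hs.2.2.2.2.2.2.2.2.2.2
    (tensorAt inp k p (i + 1)) fun t ht s' hA h13 => ?_).seq fun s' hs' => ?_
  · exact runs_tensorBody hF (hs.of_agreeOff hA) (hL.of_agreeOff hF le_rfl hA) ht h13
  obtain ⟨hA, hv⟩ := hs'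
  have hs' := hs.of_agreeOff hA
  have hL' := hL.of_agreeOff hF le_rfl hA
  refine (runs_fill (base := 3 * k ^ (2 * p + 2)) (n := k ^ (2 * p + 2)) (by omega) (by omega)
    (by norm_num) hs'.2.2.2.1 hs'.2.2.2.2.2.1 hs'.2.2.2.2.2.2.2.2.2.2
    (tensorAt inp k p (i + 1)) fun t ht s'' hA' h13 => ?_).mono le_rfl fun s'' h => ?_
  · have hs'' := hs'.of_agreeOff hA'
    have hm : s''.mem (4 * k ^ (2 * p + 2) + t) = tensorAt inp k p (i + 1) t :=
      (hA'.2 _ (by omega) (by omega)).trans (hv t ht)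
    obtain ⟨r, m⟩ := s''
    have h6 : r 6 = 4 * k ^ (2 * p + 2) := hs''.2.2.2.2.2.2.1
    have h11 : r 11 = 3 := hs''.2.2.2.2.2.2.2.2.2.2
    simp only at hm h13
    refine runs_block ?_
    simp only [establishes_index, establishes_cellFun, establishes_nil, Function.update_apply,
      IndexOp.eval, CellFun.eval, Nat.reduceEqDiff, reduceIte, h6, h11, h13, hm]
    iterate 3 refine ⟨by omega, ?_⟩
    exact ⟨((Agree.refl _ _ _).update_reg (by norm_num)).update_mem (by norm_num), trivial⟩
  · obtain ⟨hA', hv'⟩ := h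
    exact ⟨hs'.of_agreeOff hA', fun t ht => (hA'.2 _ (by omega) (by omega)).trans (hL'.1 t ht),
      fun t ht => (hA'.2 _ (by omega) (by omega)).trans (hL'.2.1 t ht), hv'⟩

/-- There is a single accumulator cell, so the double sum is split: row sums are stored in the array
at `4 k^(2p+2)` and then added up. -/
theorem runs_collect (hF : Fits S k p) {s : Store} (hs : Ready k p s) (v : ℕ → ℂ)
    (hv : ∀ t < k ^ (2 * p + 2), s.mem (4 * k ^ (2 * p + 2) + t) = v t) :
    collect.Runs S inp ((1 + (1 + k ^ (2 * p + 2) * (2 + 2))) + 1) s fun s' =>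
      s'.mem 0 = ∑ t ∈ Finset.range (k ^ (2 * p + 2)), v t := by
  have hN := hF.bounds.1
  have hS := hF.size
  refine (runs_sum hF hs v fun t ht s' hA h14 => ?_).seq fun s' hs' => ?_
  · have hs' := hs.congr fun i hi => hA.1 i (by omega)
    have hm := (hA.2 _ (by omega)).trans (hv t ht)
    obtain ⟨r, m⟩ := s'
    have h6 : r 6 = 4 * k ^ (2 * p + 2) := hs'.2.2.2.2.2.2.1
    have h8 : r 8 = 0 := hs'.2.2.2.2.2.2.2.2.1
    simp only at hm h14
    refine runs_block ?_
    simp only [establishes_index, establishes_cellFun, establishes_nil, Function.update_apply,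
      IndexOp.eval, CellFun.eval, Nat.reduceEqDiff, reduceIte, h6, h8, h14, hm]
    iterate 3 refine ⟨by omega, ?_⟩
    exact ⟨((Agree.refl _ _ _).update_reg (by norm_num)).update_mem (by norm_num), trivial⟩
  · obtain ⟨hA, hm3⟩ := hs'
    have hs' := hs.congr fun i hi => hA.1 i (by omega)
    obtain ⟨r, m⟩ := s'
    have h8 : r 8 = 0 := hs'.2.2.2.2.2.2.2.2.1
    have h11 : r 11 = 3 := hs'.2.2.2.2.2.2.2.2.2.2
    simp only at hm3
    refine runs_block (cs := []) ?_
    rw [establishes_cellFun, establishes_nil, h11, h8, hm3]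
    exact ⟨by omega, by omega, Function.update_self (0 : ℕ) _ m⟩

/-- The value computed by the program, in terms of the input. -/
def edgeValueAt (inp : Input) (k p : ℕ) : ℂ :=
  ∑ n ∈ Finset.range (k ^ (2 * p + 2)), ∑ n' ∈ Finset.range (k ^ (2 * p + 2)),
    edgeTermAt inp k p n n'

theorem runs_evaluateMain (hF : Fits S k p) (hp : inp.param 1 = p) {s : Store}
    (h0 : s.reg 0 = k) (h8 : s.reg 8 = 0) :
    evaluateMain.Runs S inp (300 * (p * k ^ (4 * p + 4))) s
      fun s' => s'.mem 0 = edgeValueAt inp k p := by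
  have hN := hF.bounds.1
  have hS := hF.size
  -- With `N = k^(2p+2)`, the leading terms are `21 p N²` from the tensors and `33 N²` from the
  -- final sum; the tables cost only `O(p N)`. The constant 300 is generous.
  have htime : (4 + ((1 + p * 2) + 7)) +
      ((1 + k ^ (2 * p + 2) * (3 + (3 + ((1 + p * 11) + 3)))) +
      ((1 + k ^ (2 * p + 2) * (3 + (8 + ((1 + p * 20) + 2)))) +
      ((1 + k ^ (2 * p + 2) * (3 + 1)) +
      ((1 + p * (1 + ((1 + k ^ (2 * p + 2) * (3 + (1 + (1 + k ^ (2 * p + 2) * (2 + 19)) + 1))) +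
        (1 + k ^ (2 * p + 2) * (3 + 2))))) +
      ((1 + k ^ (2 * p + 2) * (3 + (1 + (1 + k ^ (2 * p + 2) * (2 + (19 + 12)))))) +
        ((1 + (1 + k ^ (2 * p + 2) * (2 + 2))) + 1)))))) ≤ 300 * (p * k ^ (4 * p + 4)) := by
    have hsq : k ^ (4 * p + 4) = k ^ (2 * p + 2) * k ^ (2 * p + 2) := by
      rw [← pow_add]; congr 1; omega
    rw [hsq]
    generalize k ^ (2 * p + 2) = N at hN
    have hp1 := hF.one_le
    have h1 : N * N ≤ p * (N * N) := Nat.le_mul_of_pos_left _ hp1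
    have h2 : N ≤ N * N := Nat.le_mul_of_pos_left _ (by omega)
    have h3 : p * N ≤ p * (N * N) := Nat.mul_le_mul_left _ h2
    have h4 : p ≤ p * N := Nat.le_mul_of_pos_right _ (by omega)
    nlinarith
  refine Prog.Runs.mono (Prog.Runs.seq (runs_setup hF hp h0 h8) fun s hs => ?_) htime fun _ h => h
  refine (runs_fill (base := k ^ (2 * p + 2)) (n := k ^ (2 * p + 2)) (by omega) (by omega)
    (by norm_num) hs.2.2.2.1 hs.2.2.2.1 hs.2.2.2.2.2.2.2.2.2.2 _
    fun t ht s' hA h13 => runs_phaseBody hF (hs.of_agreeOff hA) ht h13).seq fun s₁ hs₁ => ?_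
  obtain ⟨hA₁, hv₁⟩ := hs₁
  replace hs := hs.of_agreeOff hA₁
  refine (runs_fill (base := 2 * k ^ (2 * p + 2)) (n := k ^ (2 * p + 2)) (by omega) (by omega)
    (by norm_num) hs.2.2.2.1 hs.2.2.2.2.1 hs.2.2.2.2.2.2.2.2.2.2 _
    fun t ht s' hA h13 => runs_weightBody hF (hs.of_agreeOff hA) ht h13).seq fun s₂ hs₂ => ?_
  obtain ⟨hA₂, hv₂⟩ := hs₂
  replace hs := hs.of_agreeOff hA₂
  refine (runs_fill (base := 3 * k ^ (2 * p + 2)) (n := k ^ (2 * p + 2)) (by omega) (by omega)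
    (by norm_num) hs.2.2.2.1 hs.2.2.2.2.2.1 hs.2.2.2.2.2.2.2.2.2.2 (fun _ => 1)
    fun t ht s' hA h13 => runs_one (by omega) (hs.of_agreeOff hA)).seq fun s₃ hs₃ => ?_
  obtain ⟨hA₃, hv₃⟩ := hs₃
  replace hs := hs.of_agreeOff hA₃
  have hL : Loaded inp k p (tensorAt inp k p 0) s₃ :=
    ⟨fun t ht => (hA₃.2 _ (by omega) (by omega)).trans ((hA₂.2 _ (by omega) (by omega)).trans
      (hv₁ t ht)), fun t ht => (hA₃.2 _ (by omega) (by omega)).trans (hv₂ t ht), hv₃⟩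
  refine (Prog.Runs.loop hs.2.1 (fun t s' => Ready k p s' ∧ Loaded inp k p (tensorAt inp k p t) s')
    ⟨hs, hL⟩ fun t ht s' h => runs_tensorStep hF (h.1.congr fun i hi => ?_) h.2).seq ?_
  · exact Function.update_of_ne (by omega) _ _
  intro s₄ hs₄
  obtain ⟨hs, hL⟩ := hs₄
  refine (runs_fill (base := 4 * k ^ (2 * p + 2)) (n := k ^ (2 * p + 2)) (by omega) (by omega)
    (by norm_num) hs.2.2.2.1 hs.2.2.2.2.2.2.1 hs.2.2.2.2.2.2.2.2.2.2 _
    fun t ht s' hA h13 => runs_edgeBody hF (hs.of_agreeOff hA) (hL.of_agreeOff hF le_rfl hA) ht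
      h13).seq fun s₅ hs₅ => ?_
  exact runs_collect hF (hs.of_agreeOff hs₅.1) _ hs₅.2

theorem evaluate_computes {inp : Input} {k p : ℕ} (hk : inp.param 0 = k) (hp : inp.param 1 = p)
    (hk2 : 2 ≤ k) (hp1 : 1 ≤ p) (z : ℂ) (hz : edgeValueAt inp k p = z) :
    evaluate.Computes inp (310 * k ^ (2 * p + 2)) (310 * (p * k ^ (4 * p + 4))) z := by
  have hF : Fits (310 * k ^ (2 * p + 2)) k p := ⟨hk2, hp1, by omega⟩
  obtain ⟨hN, hkN, hpk, hkk⟩ := hF.bounds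
  have hpos : 1 ≤ p * k ^ (4 * p + 4) := Nat.mul_pos hp1 (Nat.pow_pos (by omega))
  have h : evaluate.Runs (310 * k ^ (2 * p + 2)) inp (2 + (300 * (p * k ^ (4 * p + 4)) + 1))
      ⟨fun _ => 0, fun _ => 0⟩ fun s' => s'.mem 0 = edgeValueAt inp k p := by
    refine (runs_block (Q := fun s' => s'.reg 0 = k ∧ s'.reg 8 = 0 ∧ s'.reg 17 = 1) ?_).seq
      fun s' hs' => ?_
    · simp only [establishes_const, establishes_param, establishes_nil, Function.update_apply,
        Nat.reduceEqDiff, reduceIte, hk, OfNat.zero_ne_ofNat, OfNat.ofNat_ne_zero, and_true]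
      omega
    · refine Prog.Runs.ifEq (fun h => ?_) fun _ => runs_evaluateMain hF hp hs'.1 hs'.2.1
      rw [hs'.1, hs'.2.2] at h
      omega
  obtain ⟨s, t, h1, h2, h3⟩ := h
  exact ⟨s, t, h1, by omega, h3.trans hz⟩

/-- The machine has constant size here while `p` is unbounded, so the program must branch on `k`
before it loads `p`. -/
theorem evaluate_computes_of_eq_one {inp : Input} {p : ℕ} (hk : inp.param 0 = 1) (hp1 : 1 ≤ p)
    (z : ℂ) (hz : inp.data 1 0 = z) :
    evaluate.Computes inp (310 * 1 ^ (2 * p + 2)) (310 * (p * 1 ^ (4 * p + 4))) z := by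
  rw [one_pow, one_pow, mul_one, mul_one]
  have h : evaluate.Runs 310 inp (2 + (1 + 1))
      ⟨fun _ => 0, fun _ => 0⟩ fun s' => s'.mem 0 = inp.data 1 0 := by
    refine (runs_block (Q := fun s' => s'.reg 0 = 1 ∧ s'.reg 8 = 0 ∧ s'.reg 17 = 1) ?_).seq
      fun s' hs' => ?_
    · simp only [establishes_const, establishes_param, establishes_nil, Function.update_apply,
        Nat.reduceEqDiff, reduceIte, hk, OfNat.zero_ne_ofNat, OfNat.ofNat_ne_zero, and_true]
      omega
    · obtain ⟨r, m⟩ := s'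
      obtain ⟨h0, h8, h17⟩ := hs'
      simp only at h0 h8 h17
      refine Prog.Runs.ifEq (fun h => ?_) fun h => absurd (h0.trans h17.symm) h
      refine runs_block (cs := []) ?_
      rw [establishes_read, establishes_nil, h8]
      exact ⟨by norm_num, Function.update_self (0 : ℕ) _ m⟩
  obtain ⟨s, t, h1, h2, h3⟩ := h
  exact ⟨s, t, h1, by omega, h3.trans hz⟩

end ProgramTotal

/-! ## The program evaluates the formula -/

section Translation

variable {k p d : ℕ}

/-- The number with digits `x`, the least significant digit first. -/
def pathNumber (x : Fin (p + 1) → Fin k) : ℕ := finFunctionFinEquiv x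

theorem digit_pathNumber (x : Fin (p + 1) → Fin k) (t : Fin (p + 1)) :
    digit k (pathNumber x) t = x t :=
  congrArg Fin.val (congrFun (finFunctionFinEquiv.symm_apply_apply x) t)

theorem pathNumber_lt (x : Fin (p + 1) → Fin k) : pathNumber x < k ^ (p + 1) :=
  (finFunctionFinEquiv x).2

theorem pathNumber_mod (x : Fin (p + 1) → Fin k) : pathNumber x % k = x 0 := by
  have h := digit_pathNumber x 0
  rwa [digit, Fin.val_zero, pow_zero, Nat.div_one] at h

theorem pathNumber_div (x : Fin (p + 1) → Fin k) : pathNumber x / k ^ p = x (Fin.last p) := by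
  have h := digit_pathNumber x (Fin.last p)
  rwa [digit, Fin.val_last, Nat.mod_eq_of_lt] at h
  exact Nat.div_lt_of_lt_mul (by rw [← pow_succ]; exact pathNumber_lt x)

/-- The number of a ditstring. -/
def ditNumber (a : DitString k p) : ℕ := pathNumber a.pos * k ^ (p + 1) + pathNumber a.neg

theorem ditNumber_div (a : DitString k p) : ditNumber a / k ^ (p + 1) = pathNumber a.pos :=
  (mul_add_div_mod (pathNumber_lt a.neg)).1

theorem ditNumber_mod (a : DitString k p) : ditNumber a % k ^ (p + 1) = pathNumber a.neg :=
  (mul_add_div_mod (pathNumber_lt a.neg)).2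

theorem ditNumber_div_last (a : DitString k p) :
    ditNumber a / k ^ (2 * p + 1) = a.pos (Fin.last p) := by
  have h : k ^ (2 * p + 1) = k ^ (p + 1) * k ^ p := by rw [← pow_add]; congr 1; omega
  rw [h, ← Nat.div_div_eq_div_mul, ditNumber_div, pathNumber_div]

/-- Numbering each branch in base `k`, and then the pair in base `k^(p+1)`, is a bijection, which
links the loops of the program to sums over ditstrings. -/
theorem sum_range_eq_sum_ditString (F : ℕ → ℂ) :
    ∑ n ∈ Finset.range (k ^ (2 * p + 2)), F n = ∑ a : DitString k p, F (ditNumber a) := by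
  have h : k ^ (2 * p + 2) = k ^ (p + 1) * k ^ (p + 1) := by rw [← pow_add]; congr 1; omega
  rw [h, Finset.sum_range, ← finProdFinEquiv.sum_comp, ← DitString.branches.symm.sum_comp,
    ← (Equiv.prodCongr finFunctionFinEquiv finFunctionFinEquiv).sum_comp]
  refine Finset.sum_congr rfl fun q _ => ?_
  obtain ⟨a, rfl⟩ := DitString.branches.surjective q
  rw [Equiv.symm_apply_apply]
  congr 1
  simp only [DitString.branches_apply, Equiv.prodCongr_apply, Prod.map, finProdFinEquiv,
    Equiv.coe_fn_mk, ditNumber, pathNumber]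
  ring

theorem listTable_apply (F : Fin k → Fin k → ℂ) (a b : Fin k) :
    listTable F (a * k + b) = F a b := by
  have h : (a : ℕ) * k + b < k * k := mul_add_lt_mul a.2 b.2
  have hk : 0 < k := a.pos
  rw [listTable, dif_pos h]
  congr 1
  · ext
    simp only [Fin.coe_divNat]
    rw [mul_comm, Nat.mul_add_div hk, Nat.div_eq_of_lt b.2, add_zero]
  · ext
    simp only [Fin.coe_modNat]
    rw [mul_comm, Nat.mul_add_mod, Nat.mod_eq_of_lt b.2]

variable {φ : Fin k → Fin k → ℝ} {γ : Fin p → ℝ} {B : Fin p → Matrix (Fin k) (Fin k) ℂ}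
  {ψ : EuclideanSpace ℂ (Fin k)} {ξ : Fin k → Fin k → ℝ}

theorem encode_mixer (t : Fin p) (a b : Fin k) :
    (encode φ γ B ψ d ξ).data 3 ((t * k + a) * k + b) = B t a b := by
  have h1 : (a : ℕ) * k + b < k * k := mul_add_lt_mul a.2 b.2
  have h2 : ((t : ℕ) * k + a) * k + b = t * (k * k) + (a * k + b) := by ring
  have h3 : (t : ℕ) * (k * k) + (a * k + b) < p * (k * k) := mul_add_lt_mul t.2 h1
  have h4 : Fin.divNat (⟨t * (k * k) + (a * k + b), h3⟩ : Fin (p * (k * k))) = t := by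
    ext
    simp only [Fin.coe_divNat]
    rw [mul_comm, Nat.mul_add_div (by omega), Nat.div_eq_of_lt h1, add_zero]
  have h5 : ((Fin.modNat (⟨t * (k * k) + (a * k + b), h3⟩ : Fin (p * (k * k))) : Fin (k * k)) : ℕ) =
      a * k + b := by
    simp only [Fin.coe_modNat]
    rw [mul_comm, Nat.mul_add_mod, Nat.mod_eq_of_lt h1]
  rw [h2]
  show (if h : _ then _ else _) = _
  rw [dif_pos h3, h4, h5]
  exact listTable_apply (B t) a b

theorem phaseEntry_pathNumber (x y : Fin (p + 1) → Fin k) :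
    phaseEntry (encode φ γ B ψ d ξ) k p (pathNumber x) (pathNumber y) =
      Complex.exp (Complex.I *
        ((∑ t : Fin p, γ t * φ (x t.castSucc) (y t.castSucc) : ℝ) : ℂ)) := by
  rw [phaseEntry, mul_comm, Finset.sum_range, Complex.ofReal_sum]
  congr 2
  refine Finset.sum_congr rfl fun t _ => ?_
  have h1 := digit_pathNumber x t.castSucc
  have h2 := digit_pathNumber y t.castSucc
  rw [Fin.val_castSucc] at h1 h2
  rw [h1, h2]
  have h3 : (encode φ γ B ψ d ξ).data 0 (x t.castSucc * k + y t.castSucc) =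
    (φ (x t.castSucc) (y t.castSucc) : ℂ) := listTable_apply (fun a b => (φ a b : ℂ)) _ _
  have h4 : (encode φ γ B ψ d ξ).data 2 t = (γ t : ℂ) := dif_pos t.2
  rw [h3, h4, Complex.ofReal_mul, mul_comm]

/-- The inputs `φ` and `γ` are real, so conjugating the ket entry merely flips the sign of its
exponent. -/
theorem pairPhase_ditNumber (a b : DitString k p) :
    pairPhase (encode φ γ B ψ d ξ) k p (ditNumber a) (ditNumber b) =
      Complex.exp (Complex.I * (phase φ γ a b : ℂ)) := by
  rw [pairPhase, ditNumber_div, ditNumber_div, ditNumber_mod, ditNumber_mod,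
    phaseEntry_pathNumber, phaseEntry_pathNumber, Complex.star_def, ← Complex.exp_conj,
    ← Complex.exp_add]
  congr 1
  simp only [map_mul, Complex.conj_I, Complex.conj_ofReal, phase, mul_sub, Finset.sum_sub_distrib,
    Complex.ofReal_sub]
  ring

theorem weightAt_ditNumber (a : DitString k p) :
    weightAt (encode φ γ B ψ d ξ) k p (ditNumber a) = weight B ψ a := by
  have hB : ∀ (x : Fin (p + 1) → Fin k) (t : Fin p), (encode φ γ B ψ d ξ).data 3
      ((t * k + digit k (pathNumber x) (t + 1)) * k + digit k (pathNumber x) t) =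
      B t (x t.succ) (x t.castSucc) := by
    intro x t
    have h1 := digit_pathNumber x t.castSucc
    have h2 := digit_pathNumber x t.succ
    rw [Fin.val_castSucc] at h1
    rw [Fin.val_succ] at h2
    rw [h1, h2, encode_mixer]
  have hψ : ∀ i : Fin k, (encode φ γ B ψ d ξ).data 4 i = ψ i := fun i => dif_pos i.2
  rw [weightAt, ditNumber_div, ditNumber_mod, weightEntry, weight_eq, pathNumber_div,
    pathNumber_div, pathNumber_mod, pathNumber_mod, hψ, hψ, Finset.prod_range]
  simp only [hB, Fin.val_inj]
  split_ifs
  · simp only [pathAmplitude, star_mul', star_prod, Finset.prod_mul_distrib]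
    ring
  · rfl

theorem tensorAt_ditNumber (r : ℕ) (a : DitString k p) :
    tensorAt (encode φ γ B ψ d ξ) k p r (ditNumber a) = branchTensor φ γ B ψ d r a := by
  induction r generalizing a with
  | zero => rfl
  | succ r ih =>
    rw [tensorAt, branchTensor]
    beta_reduce
    rw [sum_range_eq_sum_ditString]
    have h : (encode φ γ B ψ d ξ).param 2 = d := rfl
    rw [h]
    congr 1
    refine Finset.sum_congr rfl fun b _ => ?_
    rw [ih, pairPhase_ditNumber, weightAt_ditNumber]
    ring

theorem edgeValueAt_encode :
    edgeValueAt (encode φ γ B ψ d ξ) k p = edgeValue φ γ B ψ d ξ := by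
  rw [edgeValueAt, edgeValue, sum_range_eq_sum_ditString]
  refine Finset.sum_congr rfl fun a _ => ?_
  rw [sum_range_eq_sum_ditString]
  refine Finset.sum_congr rfl fun b _ => ?_
  have h : (encode φ γ B ψ d ξ).data 1
      (a.pos (Fin.last p) * k + b.pos (Fin.last p)) =
      (ξ (a.pos (Fin.last p)) (b.pos (Fin.last p)) : ℂ) :=
    listTable_apply (fun a b => (ξ a b : ℂ)) _ _
  rw [edgeTermAt, ditNumber_div_last, ditNumber_div_last, h, pairPhase_ditNumber,
    weightAt_ditNumber, weightAt_ditNumber, tensorAt_ditNumber, tensorAt_ditNumber]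
  ring

/-- For one-level qudits the edge value is the only value of the observable. -/
theorem edgeValue_of_subsingleton {φ : Fin 1 → Fin 1 → ℝ} {γ : Fin p → ℝ}
    {B : Fin p → Matrix (Fin 1) (Fin 1) ℂ} {ψ : EuclideanSpace ℂ (Fin 1)}
    {ξ : Fin 1 → Fin 1 → ℝ} (hw : ∑ a, weight B ψ a = 1) :
    edgeValue φ γ B ψ d ξ = ξ 0 0 := by
  have hphase : ∀ a b : DitString 1 p, phase φ γ a b = 0 := fun a b =>
    Finset.sum_eq_zero fun t _ => by
      rw [Subsingleton.elim (a.pos t.castSucc) (a.neg t.castSucc),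
        Subsingleton.elim (b.pos t.castSucc) (b.neg t.castSucc), sub_self, mul_zero]
  have htensor : ∀ r (a : DitString 1 p), branchTensor φ γ B ψ d r a = 1 := by
    intro r
    induction r with
    | zero => exact fun _ => rfl
    | succ r ih =>
      intro a
      simp only [branchTensor, ih, hphase, Complex.ofReal_zero, mul_zero, Complex.exp_zero,
        mul_one, hw, one_pow]
  have hξ : ∀ i j : Fin 1, ξ i j = ξ 0 0 := fun i j => by
    rw [Subsingleton.elim i 0, Subsingleton.elim j 0]
  simp only [edgeValue, htensor, hphase, hξ, mul_one, Complex.ofReal_zero, mul_zero,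
    Complex.exp_zero, ← Finset.mul_sum, hw]

theorem evaluate_computes_edgeValue (hB : ∀ t, (B t)ᴴ * B t = 1) (hψ : ‖ψ‖ = 1) (hp : 1 ≤ p) :
    evaluate.Computes (encode φ γ B ψ d ξ) (310 * k ^ (2 * p + 2)) (310 * (p * k ^ (4 * p + 4)))
      (edgeValue φ γ B ψ d ξ) := by
  -- There is no unit vector for `k = 0`. For `k = 1` normalization of the weights makes the answer
  -- `ξ 0 0`; only this case uses unitarity.
  have hk : k = 0 ∨ k = 1 ∨ 2 ≤ k := by omega
  rcases hk with rfl | rfl | hk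
  · rw [Subsingleton.elim ψ 0, norm_zero] at hψ
    exact absurd hψ zero_ne_one
  · refine evaluate_computes_of_eq_one rfl hp _ ?_
    rw [edgeValue_of_subsingleton (sum_weight B hB ψ hψ)]
    exact listTable_apply (fun a b => (ξ a b : ℂ)) 0 0
  · exact evaluate_computes rfl rfl hk hp _ edgeValueAt_encode

end Translation

end QuditQAOA

end

/-! ### The main theorem. -/

theorem proposition1 :
    ∃ (P : QuditQAOA.Prog) (C : ℕ),
      ∀ (k p d l : ℕ) (φ : Fin k → Fin k → ℝ) (hφ : ∀ a b, φ a b = φ b a)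
        (ξ : Fin k → Fin k → ℝ) (γ : Fin p → ℝ) (β : Fin p → Fin l → ℝ)
        (U : (Fin l → ℝ) → Matrix.unitaryGroup (Fin k) ℂ)
        (ψ : EuclideanSpace ℂ (Fin k)), ‖ψ‖ = 1 →
        -- on each graph the expectation at each edge is given by the formula,
        -- and it is independent of the edge
        (∀ (V : Type*) [Fintype V] [DecidableEq V] (G : SimpleGraph V) [DecidableRel G.Adj],
          G.IsRegularOfDegree (d + 1) → ((2 * p + 2 : ℕ) : ℕ∞) ≤ G.egirth →
          (∀ u v : V, G.Adj u v →
            QuditQAOA.edgeExpectation G φ hφ γ (fun t => (U (β t) : Matrix (Fin k) (Fin k) ℂ))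
                ψ ξ u v =
              QuditQAOA.edgeValue φ γ (fun t => (U (β t) : Matrix (Fin k) (Fin k) ℂ)) ψ d ξ) ∧
          (∀ u v u' v' : V, G.Adj u v → G.Adj u' v' →
            QuditQAOA.edgeExpectation G φ hφ γ (fun t => (U (β t) : Matrix (Fin k) (Fin k) ℂ))
                ψ ξ u v =
              QuditQAOA.edgeExpectation G φ hφ γ (fun t => (U (β t) : Matrix (Fin k) (Fin k) ℂ))
                ψ ξ u' v')) ∧
        -- one program evaluates the formula, in time `O(p k^(4p+4))` and memory `O(k^(2p+2))`
        (1 ≤ p →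
          P.Computes
            (QuditQAOA.encode φ γ (fun t => (U (β t) : Matrix (Fin k) (Fin k) ℂ)) ψ d ξ)
            (C * k ^ (2 * p + 2)) (C * (p * k ^ (4 * p + 4)))
            (QuditQAOA.edgeValue φ γ (fun t => (U (β t) : Matrix (Fin k) (Fin k) ℂ)) ψ d ξ)) := by
  refine ⟨QuditQAOA.evaluate, 310, fun k p d l φ hφ ξ γ β U ψ hψ => ?_⟩
  have hU : ∀ t, (U (β t) : Matrix (Fin k) (Fin k) ℂ)ᴴ * (U (β t) : Matrix (Fin k) (Fin k) ℂ) =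
      1 := fun t => Matrix.mem_unitaryGroup_iff'.1 (U (β t)).2
  refine ⟨fun V _ _ G _ hd hg => ?_, QuditQAOA.evaluate_computes_edgeValue hU hψ⟩
  have h : ∀ u v : V, G.Adj u v → _ := fun u v huv =>
    QuditQAOA.edgeExpectation_eq_edgeValue (hφ := hφ) hd huv hg γ _ hU ψ hψ ξ
  exact ⟨h, fun u v u' v' huv huv' => (h u v huv).trans (h u' v' huv').symm⟩
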